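/- Theorem. A packing of $N$ equal disks in a square is a family of $N\ge 1$ closed disks of a common radius $r>0$ that are contained in a closed square $Q$ of the Euclidean plane and have pairwise disjoint interiors; its density is $\delta = N\pi r^2/\mathrm{area}(Q)$. Let $\delta_{\Box}(N)$ be the supremum of the densities of all packings of $N$ equal disks in a square. (a) There is an absolute constant $k>0$ such that for every $N\ge 1$ every packing of $N$ equal disks in a square, with density $\delta$, satisfies $$\frac{\pi}{\sqrt{12}}-\delta>\frac{k}{\sqrt N},$$ and moreover $\frac{\pi}{\sqrt{12}}-\delta_{\Box}(N)>\frac{k}{\sqrt N}$ for every $N\ge 1$. In particular, the order $1/\sqrt N$ in Gruber's upper bound $\frac{\pi}{\sqrt{12}}-\delta_{\Box}(N)=O(1/\sqrt N)$ cannot be improved. (b) Explicitly, for every $N\ge 1$ every such packing satisfies $$\frac{\pi}{\sqrt{12}}-\delta\ \ge\ \Bigl(\frac{\pi}{\sqrt{12}}-\frac{\pi}{4}\Bigr)\frac1{\sqrt N},\qquad \frac{\pi}{\sqrt{12}}-\frac{\pi}{4}\approx 0.1215,$$ and for every $N\ge 35$ every such packing satisfies $$\frac{\pi}{\sqrt{12}}-\delta>\frac{k_2}{\sqrt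 N},\qquad k_2=\frac{\pi}{2}\Bigl(\frac{2}{\sqrt3}-1\Bigr)\frac32\sqrt{\frac{\pi}{\sqrt{12}}-\frac12}\approx 0.2325.$$ -/

import Mathlib

noncomputable section

/-- The Euclidean plane. -/
abbrev Plane : Type := EuclideanSpace ℝ (Fin 2)

/-- The closed axis-parallel square `[0, s] × [0, s]`. -/
def axisSquare (s : ℝ) : Set Plane := {x | ∀ i, x i ∈ Set.Icc (0 : ℝ) s}

/-- `Q` is a (closed, non-degenerate) square in the plane, in arbitrary position:
it is congruent to `[0, s] × [0, s]` for some side length `s > 0`. -/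
def IsPlaneSquare (Q : Set Plane) : Prop :=
  ∃ s : ℝ, 0 < s ∧ ∃ φ : Plane ≃ᵢ Plane, Q = φ '' axisSquare s

/-- The closed disks of the common radius `r > 0` centered at `c 0, …, c (N - 1)` form a packing
in `Q`: they are contained in `Q` and have pairwise disjoint interiors. -/
structure IsDiskPacking (Q : Set Plane) {N : ℕ} (r : ℝ) (c : Fin N → Plane) : Prop where
  radius_pos : 0 < r
  subset : ∀ i, Metric.closedBall (c i) r ⊆ Q
  disjoint : ∀ i j, i ≠ j → Disjoint (Metric.ball (c i) r) (Metric.ball (c j) r)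

/-- The density of a family of equal disks in the container `Q`: the total area of the disks
divided by the area of `Q`. -/
def packingDensity (Q : Set Plane) {N : ℕ} (r : ℝ) (c : Fin N → Plane) : ℝ :=
  (∑ i, MeasureTheory.volume.real (Metric.closedBall (c i) r)) / MeasureTheory.volume.real Q

/-- The maximum density of a packing of `N` equal disks in a square. -/
def maxSquareDensity (N : ℕ) : ℝ :=
  sSup {δ : ℝ | ∃ (Q : Set Plane) (r : ℝ) (c : Fin N → Plane),
    IsPlaneSquare Q ∧ IsDiskPacking Q r c ∧ δ = packingDensity Q r c}

end

open MeasureTheory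

/-! Let `u` be the side of the square divided by the disk diameter, `n = √N` and `q = 2/√3`. The
centers, rescaled by the diameter, are `N` points at mutual distance at least `1` in a square of
side `t = u - 1`. The theorem rests on Groemer's inequality `card_le_of_one_le_dist`, which reads
`n² ≤ u² + (q - 1)(u - 1)²` in these terms. Since the density is `π n² / (4 u²)` and `π/√12 = π q /
4`, the deficiency is `(π/4)(q u² - n²)/u² ≥ (π/4)(q - 1)(2u - 1)/u²`, which has order `1/u`: this
is the loss along the boundary. Elementary estimates (`deficiency_ge`, `lt_deficiency`) trade `u`
for `n`.

Groemer's inequality is proved by an area count with disks of radius `R = 1/√3` about the points. No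
three of them overlap (`not_three_close`). Each overlap of two is cut by the common chord into caps,
a cap takes at most the fraction `1 - 3√3/(2π)` of its sector (`volume_real_halfCap_le`), and the
sectors at one center are disjoint (`disjoint_pairSector`). So a full disk, of area `π/3`, accounts
for an area of at least `3√3/(2π) · π/3 = √3/2`.

The square causes two corrections. A sector may be cut by a side, but only if its tip lies outside;
the error is then at most `3/40` times the sum of the distances of the two centers from that side,
and these errors add up to at most `3/10` times the sum of the distances less than `R`
(`sum_outside_tips_le`). Moreover a disk may stick out of the square. To compensate, a point at
distance `h < R` from a side receives an interval of length `1 - h` on that side. These intervals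
are disjoint (`sum_shadow_le`), so they have total length at most `t` per side, and at most one
point is close to both sides of a given corner (`sum_corner_le_one`). `corner_inequality` shows,
quadrant by quadrant, that the remaining disk area and these credits pay for `√3/2` per point and
for the errors. Four sides at `√3/4 · t` and four corners at `√3/8` give the boundary term `√3 t +
√3/2`. -/

/-! ### Areas of sectors, triangles and caps -/

theorem volume_real_sector {R θ : ℝ} (hR : 0 ≤ R) (hθ : 0 ≤ θ) (hθ' : θ ≤ Real.pi) :
    volume.real {z : ℂ | 0 < z.arg ∧ z.arg < θ ∧ ‖z‖ < R} = R ^ 2 * θ / 2 := by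
  have hm : MeasurableSet {z : ℂ | 0 < z.arg ∧ z.arg < θ ∧ ‖z‖ < R} := by measurability
  rw [← integral_indicator_one hm, ← Complex.integral_comp_polarCoord_symm,
    polarCoord_target]
  have h1 : ∀ p ∈ Set.Ioi (0 : ℝ) ×ˢ Set.Ioo (-Real.pi) Real.pi,
      p.1 • ({z : ℂ | 0 < z.arg ∧ z.arg < θ ∧ ‖z‖ < R}.indicator (1 : ℂ → ℝ)
        (Complex.polarCoord.symm p)) =
      (Set.Ioo 0 R ×ˢ Set.Ioo 0 θ).indicator (fun p : ℝ × ℝ => p.1 * (1 : ℝ)) p := by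
    rintro ⟨r, a⟩ ⟨hr, ha⟩
    simp only [Set.mem_Ioi, Set.mem_Ioo] at hr ha
    have e1 : ‖Complex.polarCoord.symm (r, a)‖ = r := by
      rw [Complex.norm_polarCoord_symm, abs_of_pos hr]
    have e2 : (Complex.polarCoord.symm (r, a)).arg = a := by
      rw [Complex.polarCoord_symm_apply]
      push_cast
      exact Complex.arg_mul_cos_add_sin_mul_I hr ⟨ha.1, ha.2.le⟩
    simp only [Set.indicator_apply, Set.mem_ofPred_eq, e1, e2, Set.mem_prod, Set.mem_Ioo]
    by_cases hc : 0 < a ∧ a < θ ∧ r < R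
    · rw [if_pos hc, if_pos ⟨⟨hr, hc.2.2⟩, hc.1, hc.2.1⟩]; simp
    · rw [if_neg hc, if_neg (fun h => hc ⟨h.2.1, h.2.2, h.1.2⟩)]; simp
  rw [setIntegral_congr_fun (measurableSet_Ioi.prod measurableSet_Ioo) h1,
    setIntegral_indicator (measurableSet_Ioo.prod measurableSet_Ioo)]
  have h2 : Set.Ioi (0 : ℝ) ×ˢ Set.Ioo (-Real.pi) Real.pi ∩ Set.Ioo 0 R ×ˢ Set.Ioo 0 θ
      = Set.Ioo 0 R ×ˢ Set.Ioo 0 θ := by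
    apply Set.inter_eq_right.2
    rintro ⟨r, a⟩ ⟨hr, ha⟩
    exact ⟨hr.1, by linarith [ha.1, Real.pi_pos], by linarith [ha.2]⟩
  rw [h2, Measure.volume_eq_prod, setIntegral_prod_mul (fun r : ℝ => r) (fun _ : ℝ => (1 : ℝ))]
  rw [← integral_Ioc_eq_integral_Ioo, ← integral_Ioc_eq_integral_Ioo,
    ← intervalIntegral.integral_of_le hR, ← intervalIntegral.integral_of_le hθ]
  simp
  ring

theorem volume_real_right_triangle {l m : ℝ} (hl : 0 ≤ l) (hm : 0 ≤ m) :
    volume.real {z : ℂ | 0 < z.re ∧ z.re < l ∧ 0 < z.im ∧ z.im < m * z.re} = m * l ^ 2 / 2 := by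
  have h1 : {z : ℂ | 0 < z.re ∧ z.re < l ∧ 0 < z.im ∧ z.im < m * z.re} =
      Complex.measurableEquivRealProd ⁻¹'
        (regionBetween (fun _ => (0 : ℝ)) (fun x => m * x) (Set.Ioo 0 l)) := by
    ext z
    simp [regionBetween, Complex.measurableEquivRealProd_apply, and_assoc]
  have hr : MeasurableSet
      (regionBetween (fun _ => (0 : ℝ)) (fun x => m * x) (Set.Ioo 0 l)) :=
    measurableSet_regionBetween measurable_const (by fun_prop) measurableSet_Ioo
  rw [h1, measureReal_def,
    Complex.volume_preserving_equiv_real_prod.measure_preimage hr.nullMeasurableSet,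
    Measure.volume_eq_prod, volume_regionBetween_eq_integral (by simp)
      ((by fun_prop : Continuous fun x : ℝ => m * x).integrableOn_Icc.mono_set
        Set.Ioo_subset_Icc_self) measurableSet_Ioo
      (fun x hx => mul_nonneg hm hx.1.le)]
  have h2 : ∫ y in Set.Ioo 0 l, ((fun x => m * x) - (fun _ => 0) : ℝ → ℝ) y = m * l ^ 2 / 2 := by
    rw [← integral_Ioc_eq_integral_Ioo, ← intervalIntegral.integral_of_le hl]
    simp only [Pi.sub_apply, sub_zero]
    rw [intervalIntegral.integral_const_mul, integral_id]
    ring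
  rw [h2, ENNReal.toReal_ofReal (by positivity)]

/-- Concavity puts the graph of `sin` above its chord over `[0, π/3]`; this is evaluated at `2θ`.
Equality at `θ = π/6` is the hexagonal lattice, so the constant is sharp. -/
theorem mul_le_sin_two_mul {θ : ℝ} (h0 : 0 ≤ θ) (h1 : θ ≤ Real.pi / 6) :
    3 * √3 / (2 * Real.pi) * θ ≤ Real.sin θ * Real.cos θ := by
  have hpi := Real.pi_pos
  have hc := strictConcaveOn_sin_Icc.concaveOn
  have h3 := hc.2 (show (0 : ℝ) ∈ Set.Icc 0 Real.pi by simp [hpi.le])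
    (show Real.pi / 3 ∈ Set.Icc 0 Real.pi from ⟨by positivity, by linarith⟩)
    (show 0 ≤ 1 - 6 * θ / Real.pi by rw [sub_nonneg, div_le_one hpi]; linarith)
    (show 0 ≤ 6 * θ / Real.pi by positivity) (by ring)
  have e : (1 - 6 * θ / Real.pi) • (0 : ℝ) + (6 * θ / Real.pi) • (Real.pi / 3) = 2 * θ := by
    simp only [smul_eq_mul]; field_simp; ring
  rw [e, Real.sin_two_mul, Real.sin_pi_div_three] at h3
  simp only [Real.sin_zero, smul_eq_mul, mul_zero, zero_add] at h3
  have e2 : 3 * √3 / (2 * Real.pi) * θ = (6 * θ / Real.pi * (√3 / 2)) / 2 := by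
    field_simp; ring
  rw [e2]; linarith

/-- The upper half of the circular segment cut off by the chord of half-angle `θ`. -/
def halfCap (R θ : ℝ) : Set ℂ := {z | R * Real.cos θ ≤ z.re ∧ 0 ≤ z.im ∧ ‖z‖ < R}

/-- The circular sector with polar angles between `0` and `θ`, for `0 < θ < π / 2`. -/
def halfSector (R θ : ℝ) : Set ℂ :=
  {z | 0 < z.im ∧ z.im * Real.cos θ < z.re * Real.sin θ ∧ ‖z‖ < R}

theorem measurableSet_halfCap (R θ : ℝ) : MeasurableSet (halfCap R θ) := by
  unfold halfCap; measurability

theorem measurableSet_halfSector (R θ : ℝ) : MeasurableSet (halfSector R θ) := by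
  unfold halfSector
  exact (measurableSet_lt measurable_const Complex.measurable_im).inter
    ((measurableSet_lt (Complex.measurable_im.mul_const _) (Complex.measurable_re.mul_const _)).inter
      (measurableSet_lt measurable_norm measurable_const))

theorem volume_ne_top_of_norm_lt {R : ℝ} {s : Set ℂ} (h : ∀ z ∈ s, ‖z‖ < R) :
    volume s ≠ ⊤ :=
  ((measure_mono (fun z hz => by simpa using h z hz : s ⊆ Metric.ball 0 R)).trans_lt
    measure_ball_lt_top).ne

theorem volume_im_eq_zero : volume {z : ℂ | z.im = 0} = 0 := by
  have h1 : {z : ℂ | z.im = 0} = Complex.measurableEquivRealProd ⁻¹' (Set.univ ×ˢ {0}) := by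
    ext z; simp [Complex.measurableEquivRealProd_apply]
  rw [h1, Complex.volume_preserving_equiv_real_prod.measure_preimage
    (MeasurableSet.univ.prod (measurableSet_singleton _)).nullMeasurableSet,
    Measure.volume_eq_prod, Measure.prod_prod]
  simp

theorem volume_real_halfSector_le {R θ : ℝ} (hR : 0 ≤ R) (h0 : 0 < θ)
    (h1 : θ ≤ Real.pi / 6) : volume.real (halfSector R θ) ≤ R ^ 2 * θ / 2 := by
  have hpi := Real.pi_pos
  rw [← volume_real_sector hR h0.le (by linarith)]
  apply measureReal_mono _ (volume_ne_top_of_norm_lt fun z hz => hz.2.2)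
  rintro z ⟨hi, hc, hn⟩
  have harg : 0 < z.arg := by
    refine lt_of_le_of_ne (Complex.arg_nonneg_iff.2 hi.le) fun h => ?_
    have := (Complex.arg_eq_zero_iff.1 h.symm).2
    exact hi.ne' this
  refine ⟨harg, ?_, hn⟩
  by_contra! hcon
  have h2 : 0 ≤ Real.sin (z.arg - θ) :=
    Real.sin_nonneg_of_nonneg_of_le_pi (by linarith) (by linarith [Complex.arg_le_pi z])
  have h3 := mul_nonneg (norm_nonneg z) h2
  rw [Real.sin_sub] at h3
  have e1 := Complex.norm_mul_cos_arg z
  have e2 := Complex.norm_mul_sin_arg z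
  have : ‖z‖ * (Real.sin z.arg * Real.cos θ - Real.cos z.arg * Real.sin θ)
      = z.im * Real.cos θ - z.re * Real.sin θ := by rw [← e1, ← e2]; ring
  linarith

/-- Up to a null segment, the cap lies in the sector minus the right triangle below the chord. The
triangle has area `R² sin θ cos θ / 2`, at least the fraction `3√3/(2π)` of the sector by
`mul_le_sin_two_mul`. -/
theorem volume_real_halfCap_le {R θ : ℝ} (hR : 0 < R) (h0 : 0 < θ) (h1 : θ ≤ Real.pi / 6) :
    volume.real (halfCap R θ) ≤
      (1 - 3 * √3 / (2 * Real.pi)) * volume.real (halfSector R θ) := by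
  have hpi := Real.pi_pos
  have hs : 0 < Real.sin θ := Real.sin_pos_of_pos_of_lt_pi h0 (by linarith)
  have hk : 0 < Real.cos θ := Real.cos_pos_of_mem_Ioo ⟨by linarith, by linarith⟩
  have hsk := Real.sin_sq_add_cos_sq θ
  set s := Real.sin θ with hsd
  set k := Real.cos θ with hkd
  set T : Set ℂ := {z | 0 < z.re ∧ z.re < R * k ∧ 0 < z.im ∧ z.im < s / k * z.re} with hT
  have hTsub : T ⊆ halfSector R θ := by
    rintro z ⟨a1, a2, a3, a4⟩
    have a5 : z.im * k < z.re * s := by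
      rw [div_mul_eq_mul_div, lt_div_iff₀ hk] at a4; linarith
    refine ⟨a3, a5, ?_⟩
    have a6 : (z.im * k) ^ 2 < (z.re * s) ^ 2 := by
      apply pow_lt_pow_left₀ a5 (by positivity) (by norm_num)
    have a7 : z.re ^ 2 < (R * k) ^ 2 := pow_lt_pow_left₀ a2 a1.le (by norm_num)
    have a8 : ‖z‖ ^ 2 < R ^ 2 := by
      rw [← Complex.normSq_eq_norm_sq, Complex.normSq_apply]
      have : k ^ 2 * (z.re * z.re + z.im * z.im) < k ^ 2 * R ^ 2 := by
        calc k ^ 2 * (z.re * z.re + z.im * z.im) = z.re ^ 2 * k ^ 2 + (z.im * k) ^ 2 := by ring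
          _ < z.re ^ 2 * k ^ 2 + (z.re * s) ^ 2 := by linarith
          _ = z.re ^ 2 * (s ^ 2 + k ^ 2) := by ring
          _ = z.re ^ 2 := by rw [hsk, mul_one]
          _ < _ := by linarith [mul_pow R k 2]
      exact lt_of_mul_lt_mul_left this (by positivity)
    exact lt_of_pow_lt_pow_left₀ 2 hR.le a8
  have hTm : MeasurableSet T := by
    have : T = {z : ℂ | 0 < z.re} ∩ ({z | z.re < R * k} ∩ ({z | 0 < z.im} ∩
      {z | z.im < s / k * z.re})) := rfl
    rw [this]
    exact (measurableSet_lt (by fun_prop) (by fun_prop)).inter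
      ((measurableSet_lt (by fun_prop) (by fun_prop)).inter
      ((measurableSet_lt (by fun_prop) (by fun_prop)).inter
      (measurableSet_lt (by fun_prop) (by fun_prop))))
  have hTv : volume.real T = R ^ 2 * (s * k) / 2 := by
    rw [hT, volume_real_right_triangle (by positivity) (by positivity)]
    field_simp
  have hfin : volume (halfSector R θ) ≠ ⊤ := volume_ne_top_of_norm_lt fun z hz => hz.2.2
  have hcap : volume.real (halfCap R θ) ≤ volume.real (halfSector R θ \ T) := by
    have h2 : halfCap R θ ⊆ (halfSector R θ \ T) ∪ {z | z.im = 0} := by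
      rintro z ⟨b1, b2, b3⟩
      rcases b2.eq_or_lt with b2 | b2
      · exact Or.inr b2.symm
      left
      refine ⟨⟨b2, ?_, b3⟩, fun h => absurd h.2.1 (not_lt.2 b1)⟩
      have b4 : z.re ^ 2 + z.im ^ 2 < R ^ 2 := by
        have := pow_lt_pow_left₀ b3 (norm_nonneg z) (two_ne_zero)
        rw [← Complex.normSq_eq_norm_sq, Complex.normSq_apply] at this
        nlinarith
      have b5 : (R * k) ^ 2 ≤ z.re ^ 2 := pow_le_pow_left₀ (by positivity) b1 2
      have b6 : z.im ^ 2 < (R * s) ^ 2 := by nlinarith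
      have b7 : z.im < R * s := lt_of_pow_lt_pow_left₀ 2 (by positivity) b6
      calc z.im * k < R * s * k := by gcongr
        _ = R * k * s := by ring
        _ ≤ z.re * s := by gcongr
    calc volume.real (halfCap R θ)
        ≤ volume.real ((halfSector R θ \ T) ∪ {z : ℂ | z.im = 0}) :=
          measureReal_mono h2 (measure_union_ne_top
            (measure_ne_top_of_subset Set.sdiff_subset hfin) (by rw [volume_im_eq_zero]; simp))
      _ ≤ volume.real (halfSector R θ \ T) + volume.real {z : ℂ | z.im = 0} :=
          measureReal_union_le _ _
      _ = _ := by rw [measureReal_def volume {z : ℂ | z.im = 0}, volume_im_eq_zero]; simp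
  rw [measureReal_sdiff hTsub hTm hfin, hTv] at hcap
  have hS := volume_real_halfSector_le hR.le h0 h1
  have hsin := mul_le_sin_two_mul h0.le h1
  have hc0 : 0 ≤ 3 * √3 / (2 * Real.pi) := by positivity
  have h5 : 3 * √3 / (2 * Real.pi) * volume.real (halfSector R θ) ≤ R ^ 2 * (s * k) / 2 := by
    calc _ ≤ 3 * √3 / (2 * Real.pi) * (R ^ 2 * θ / 2) := by gcongr
      _ = R ^ 2 * (3 * √3 / (2 * Real.pi) * θ) / 2 := by ring
      _ ≤ _ := by gcongr
  linarith

/-! ### Caps and sectors of a pair of overlapping disks -/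

/-- The circumradius of the equilateral triangle of side length `1`. -/
noncomputable def hexRadius : ℝ := 1 / √3

theorem hexRadius_pos : 0 < hexRadius := by unfold hexRadius; positivity

theorem hexRadius_sq : hexRadius ^ 2 = 1 / 3 := by
  unfold hexRadius; rw [div_pow, Real.sq_sqrt (by norm_num)]; norm_num

theorem hexRadius_lt : hexRadius < 0.5774 := by
  nlinarith [hexRadius_sq, hexRadius_pos]

theorem lt_hexRadius : 0.5773 < hexRadius := by
  nlinarith [hexRadius_sq, hexRadius_pos]

theorem exists_frame (v : ℂ) : ∃ e : ℂ ≃ₗᵢ[ℝ] ℂ, e (‖v‖ : ℂ) = v := by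
  by_cases hv : v = 0
  · exact ⟨LinearIsometryEquiv.refl ℝ ℂ, by simp [hv]⟩
  · have hn : (‖v‖ : ℂ) ≠ 0 := by simpa using hv
    have hu : v / ‖v‖ ∈ Submonoid.unitSphere ℂ :=
      mem_sphere_zero_iff_norm.2 (by simp [hv])
    exact ⟨rotation ⟨v / ‖v‖, hu⟩, div_mul_cancel₀ v hn⟩

/-- The two isometries fixing the origin and taking the positive real axis to the ray
through `v`. -/
noncomputable def frame (v : ℂ) (b : Bool) : ℂ ≃ₗᵢ[ℝ] ℂ :=
  if b then Complex.conjLIE.trans (exists_frame v).choose else (exists_frame v).choose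

theorem frame_norm (v : ℂ) (b : Bool) : frame v b (‖v‖ : ℂ) = v := by
  cases b
  · exact (exists_frame v).choose_spec
  · simpa [frame] using (exists_frame v).choose_spec

theorem frame_symm_not (v : ℂ) (b : Bool) (z : ℂ) :
    (frame v (!b)).symm z = (starRingEnd ℂ) ((frame v b).symm z) := by
  cases b
  · rw [LinearIsometryEquiv.symm_apply_eq]; simp [frame]
  · rw [LinearIsometryEquiv.symm_apply_eq]; simp [frame]

theorem frame_not (v : ℂ) (b : Bool) (z : ℂ) :
    frame v (!b) z = frame v b ((starRingEnd ℂ) z) := by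
  cases b <;> simp [frame]

theorem inner_frame_symm (v : ℂ) (b : Bool) (z : ℂ) :
    inner ℝ z v = ((frame v b).symm z).re * ‖v‖ := by
  conv_lhs => rw [← frame_norm v b, ← (frame v b).apply_symm_apply z]
  rw [LinearIsometryEquiv.inner_map_map, Complex.inner]
  simp [mul_comm]

theorem measurePreserving_frame_symm (p v : ℂ) (b : Bool) :
    MeasurePreserving (fun x => (frame v b).symm (x - p)) volume volume :=
  (frame v b).symm.measurePreserving.comp (measurePreserving_sub_right volume p)

/-- The half-angle under which the common chord of the disks of radius `hexRadius` centered at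
`p` and `q` is seen from `p`. -/
noncomputable def chordAngle (p q : ℂ) : ℝ := Real.arccos (‖q - p‖ / (2 * hexRadius))

theorem cos_chordAngle {p q : ℂ} (h1 : 1 ≤ ‖q - p‖) (h2 : ‖q - p‖ < 2 * hexRadius) :
    Real.cos (chordAngle p q) = ‖q - p‖ / (2 * hexRadius) := by
  have hR := hexRadius_pos
  apply Real.cos_arccos
  · have : 0 ≤ ‖q - p‖ / (2 * hexRadius) := by positivity
    linarith
  · rw [div_le_one (by positivity)]; exact h2.le

theorem norm_eq_mul_cos {p q : ℂ} (h1 : 1 ≤ ‖q - p‖) (h2 : ‖q - p‖ < 2 * hexRadius) :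
    ‖q - p‖ = 2 * hexRadius * Real.cos (chordAngle p q) := by
  have hR := hexRadius_pos
  rw [cos_chordAngle h1 h2]; field_simp

theorem chordAngle_pos {p q : ℂ} (h2 : ‖q - p‖ < 2 * hexRadius) : 0 < chordAngle p q := by
  have hR := hexRadius_pos
  apply Real.arccos_pos.2
  rwa [div_lt_one (by positivity)]

theorem chordAngle_le {p q : ℂ} (h1 : 1 ≤ ‖q - p‖) : chordAngle p q ≤ Real.pi / 6 := by
  have hR := hexRadius_pos
  have hpi := Real.pi_pos
  have : Real.pi / 6 = Real.arccos (Real.cos (Real.pi / 6)) :=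
    (Real.arccos_cos (by positivity) (by linarith)).symm
  rw [this, Real.cos_pi_div_six]
  apply Real.arccos_le_arccos
  rw [le_div_iff₀ (by positivity)]
  have : √3 / 2 * (2 * hexRadius) = 1 := by unfold hexRadius; field_simp
  linarith

/-- The part of the disk of radius `hexRadius` centered at `p` that is at least as close to `q`,
on one side of the line through `p` and `q`. -/
noncomputable def pairCap (p q : ℂ) (b : Bool) : Set ℂ :=
  (fun x => (frame (q - p) b).symm (x - p)) ⁻¹' halfCap hexRadius (chordAngle p q)

/-- The half-sector at `p` spanned by `pairCap p q b`. -/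
noncomputable def pairSector (p q : ℂ) (b : Bool) : Set ℂ :=
  (fun x => (frame (q - p) b).symm (x - p)) ⁻¹' halfSector hexRadius (chordAngle p q)

/-- One of the two intersection points of the circles of radius `hexRadius` centered at
`p` and `q`. -/
noncomputable def pairTip (p q : ℂ) (b : Bool) : ℂ :=
  p + frame (q - p) b ⟨‖q - p‖ / 2, hexRadius * Real.sin (chordAngle p q)⟩

theorem measurableSet_pairCap (p q : ℂ) (b : Bool) : MeasurableSet (pairCap p q b) :=
  (measurePreserving_frame_symm p (q - p) b).measurable (measurableSet_halfCap _ _)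

theorem measurableSet_pairSector (p q : ℂ) (b : Bool) : MeasurableSet (pairSector p q b) :=
  (measurePreserving_frame_symm p (q - p) b).measurable (measurableSet_halfSector _ _)

theorem pairCap_subset_ball (p q : ℂ) (b : Bool) : pairCap p q b ⊆ Metric.ball p hexRadius := by
  intro x hx
  have := hx.2.2
  rwa [LinearIsometryEquiv.norm_map, ← dist_eq_norm] at this

theorem pairSector_subset_ball (p q : ℂ) (b : Bool) :
    pairSector p q b ⊆ Metric.ball p hexRadius := by
  intro x hx
  have := hx.2.2
  rwa [LinearIsometryEquiv.norm_map, ← dist_eq_norm] at this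

theorem volume_real_pairCap_le {p q : ℂ} (h1 : 1 ≤ ‖q - p‖) (h2 : ‖q - p‖ < 2 * hexRadius)
    (b : Bool) : volume.real (pairCap p q b) ≤
      (1 - 3 * √3 / (2 * Real.pi)) * volume.real (pairSector p q b) := by
  have hm := measurePreserving_frame_symm p (q - p) b
  unfold pairCap pairSector
  rw [hm.measureReal_preimage (measurableSet_halfCap _ _).nullMeasurableSet,
    hm.measureReal_preimage (measurableSet_halfSector _ _).nullMeasurableSet]
  exact volume_real_halfCap_le hexRadius_pos (chordAngle_pos h2) (chordAngle_le h1)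

theorem mem_pairCap_of_dist_le {p q x : ℂ} (h1 : 1 ≤ ‖q - p‖) (hx : dist x p < hexRadius)
    (hxq : dist x q ≤ dist x p) :
    ‖q - p‖ < 2 * hexRadius ∧ ∃ b, x ∈ pairCap p q b := by
  have h2 : ‖q - p‖ < 2 * hexRadius := by
    rw [← dist_eq_norm]
    linarith [dist_triangle_left q p x]
  refine ⟨h2, ?_⟩
  have hre : ∀ b, hexRadius * Real.cos (chordAngle p q) ≤
      ((frame (q - p) b).symm (x - p)).re := by
    intro b
    have e1 := inner_frame_symm (q - p) b (x - p)
    have e2 : dist x q ^ 2 ≤ dist x p ^ 2 := pow_le_pow_left₀ dist_nonneg hxq 2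
    have e3 : x - q = (x - p) - (q - p) := by ring
    rw [dist_eq_norm, dist_eq_norm, e3, norm_sub_sq_real, e1] at e2
    have e4 := norm_eq_mul_cos h1 h2
    have : 0 < ‖q - p‖ := by linarith
    nlinarith
  have hn : ∀ b, ‖(frame (q - p) b).symm (x - p)‖ < hexRadius := by
    intro b
    rwa [LinearIsometryEquiv.norm_map, ← dist_eq_norm]
  rcases le_total 0 ((frame (q - p) false).symm (x - p)).im with h | h
  · exact ⟨false, hre _, h, hn _⟩
  · refine ⟨true, hre _, ?_, hn _⟩
    have := frame_symm_not (q - p) false (x - p)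
    simp only [Bool.not_false] at this
    change 0 ≤ ((frame (q - p) true).symm (x - p)).im
    rw [this, Complex.conj_im]
    linarith

/-- A point cannot be close to three points at mutual distance at least `1`. -/
theorem not_three_close {y p q r : ℂ} (hpq : 1 ≤ ‖q - p‖) (hpr : 1 ≤ ‖r - p‖)
    (hqr : 1 ≤ ‖r - q‖) (hp : ‖y - p‖ ≤ hexRadius) (hq : ‖y - q‖ < hexRadius)
    (hr : ‖y - r‖ < hexRadius) : False := by
  have hR := hexRadius_sq
  have a1 := pow_le_pow_left₀ (norm_nonneg _) hp 2
  have a2 := pow_lt_pow_left₀ hq (norm_nonneg _) two_ne_zero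
  have a3 := pow_lt_pow_left₀ hr (norm_nonneg _) two_ne_zero
  have b1 := pow_le_pow_left₀ zero_le_one hpq 2
  have b2 := pow_le_pow_left₀ zero_le_one hpr 2
  have b3 := pow_le_pow_left₀ zero_le_one hqr 2
  simp only [← Complex.normSq_eq_norm_sq, Complex.normSq_apply, Complex.sub_re,
    Complex.sub_im] at *
  -- Lagrange's identity: three times the sum of the squared distances from `y` equals the sum of
  -- the squared mutual distances plus `|3y - p - q - r|²`. The former is less than `3`, the latter
  -- at least `3`.
  nlinarith [sq_nonneg (3 * y.re - p.re - q.re - r.re), sq_nonneg (3 * y.im - p.im - q.im - r.im)]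

/-- Pushing `x` radially from `p` onto the circle of radius `hexRadius` lands on the open arc that
the disk about `q` cuts off. This turns overlapping sectors into a point close to three centers. -/
theorem norm_sub_lt_of_mem_pairSector {p q x : ℂ} {b : Bool} (h1 : 1 ≤ ‖q - p‖)
    (h2 : ‖q - p‖ < 2 * hexRadius) (hx : x ∈ pairSector p q b) :
    ‖p + ((hexRadius / ‖x - p‖ : ℝ) : ℂ) * (x - p) - p‖ ≤ hexRadius ∧
    ‖p + ((hexRadius / ‖x - p‖ : ℝ) : ℂ) * (x - p) - q‖ < hexRadius := by
  obtain ⟨c1, c2, c3⟩ := hx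
  have hR := hexRadius_pos
  have hpi := Real.pi_pos
  have ht0 := chordAngle_pos h2
  have ht1 := chordAngle_le h1
  have hs : 0 < Real.sin (chordAngle p q) := Real.sin_pos_of_pos_of_lt_pi ht0 (by linarith)
  have hk : 0 < Real.cos (chordAngle p q) :=
    Real.cos_pos_of_mem_Ioo ⟨by linarith, by linarith⟩
  have hsk := Real.sin_sq_add_cos_sq (chordAngle p q)
  have hd := norm_eq_mul_cos h1 h2
  have e1 := inner_frame_symm (q - p) b (x - p)
  have hnz : ‖(frame (q - p) b).symm (x - p)‖ = ‖x - p‖ := LinearIsometryEquiv.norm_map _ _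
  set z := (frame (q - p) b).symm (x - p)
  set s := Real.sin (chordAngle p q)
  set k := Real.cos (chordAngle p q)
  set w := x - p with hw
  have hzre : 0 < z.re := by
    by_contra! hcon
    have := mul_pos c1 hk
    nlinarith
  have hzn : ‖z‖ ^ 2 = z.re ^ 2 + z.im ^ 2 := by
    rw [← Complex.normSq_eq_norm_sq, Complex.normSq_apply]; ring
  have hw0 : 0 < ‖w‖ := by
    rw [← hnz]; exact norm_pos_iff.2 fun h => by simp [h] at hzre
  have key : ‖w‖ * k < z.re := by
    rw [← hnz]
    apply lt_of_pow_lt_pow_left₀ 2 hzre.le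
    rw [mul_pow, hzn]
    have := pow_lt_pow_left₀ c2 (by positivity) two_ne_zero
    nlinarith
  have hny : ‖((hexRadius / ‖w‖ : ℝ) : ℂ) * w‖ = hexRadius := by
    rw [norm_mul, Complex.norm_real, Real.norm_eq_abs, abs_of_pos (by positivity)]
    field_simp
  refine ⟨by rw [add_sub_cancel_left]; exact hny.le, ?_⟩
  have e3 : p + ((hexRadius / ‖w‖ : ℝ) : ℂ) * w - q =
    (hexRadius / ‖w‖ : ℝ) • w - (q - p) := by rw [Complex.real_smul]; ring
  apply lt_of_pow_lt_pow_left₀ 2 hR.le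
  rw [e3, norm_sub_sq_real, inner_smul_left, e1, Complex.real_smul, hny]
  simp only [conj_trivial]
  have h6 : hexRadius * ‖q - p‖ * k < hexRadius / ‖w‖ * (z.re * ‖q - p‖) := by
    rw [div_mul_eq_mul_div, lt_div_iff₀ hw0]
    have : 0 < hexRadius * ‖q - p‖ := by positivity
    nlinarith
  have h7 : hexRadius * ‖q - p‖ * k = ‖q - p‖ ^ 2 / 2 := by
    rw [sq]; nth_rewrite 3 [hd]; ring
  linarith

theorem disjoint_pairSector_not (p q : ℂ) (b : Bool) :
    Disjoint (pairSector p q b) (pairSector p q !b) := by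
  rw [Set.disjoint_left]
  intro x hx hx'
  have h1 := hx.1
  have h2 := hx'.1
  simp only [frame_symm_not, Complex.conj_im] at h2
  linarith

/-- The radial projection of a common point would be at distance at most `hexRadius` from `p` and
less than `hexRadius` from both `q` and `r`. -/
theorem disjoint_pairSector {p q r : ℂ} (hpq : 1 ≤ ‖q - p‖) (hpr : 1 ≤ ‖r - p‖)
    (hqr : 1 ≤ ‖r - q‖) (hq : ‖q - p‖ < 2 * hexRadius) (hr : ‖r - p‖ < 2 * hexRadius)
    (b b' : Bool) : Disjoint (pairSector p q b) (pairSector p r b') := by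
  rw [Set.disjoint_left]
  intro x hx hx'
  obtain ⟨h1, h2⟩ := norm_sub_lt_of_mem_pairSector hpq hq hx
  obtain ⟨-, h3⟩ := norm_sub_lt_of_mem_pairSector hpr hr hx'
  exact not_three_close hpq hpr hqr h1 h2 h3

/-- The sector lies in the triangle with vertices `p`, `q` and the tip: the angle of that triangle
at the tip is `π - 2θ ≥ π/2`, so its side from the tip to `q` does not enter the disk about `p`. -/
theorem pairSector_subset_of_tip_mem {p q : ℂ} {b : Bool} {Q : Set ℂ} (hQ : Convex ℝ Q)
    (h1 : 1 ≤ ‖q - p‖) (h2 : ‖q - p‖ < 2 * hexRadius) (hp : p ∈ Q) (hq : q ∈ Q)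
    (hT : pairTip p q b ∈ Q) : pairSector p q b ⊆ Q := by
  rintro x ⟨c1, c2, c3⟩
  have hR := hexRadius_pos
  have hpi := Real.pi_pos
  have ht0 := chordAngle_pos h2
  have ht1 := chordAngle_le h1
  have hd := norm_eq_mul_cos h1 h2
  have hd0 : 0 < ‖q - p‖ := by linarith
  have hv := frame_norm (q - p) b
  have hs : 0 < Real.sin (chordAngle p q) := Real.sin_pos_of_pos_of_lt_pi ht0 (by linarith)
  have hk : 0 < Real.cos (chordAngle p q) :=
    Real.cos_pos_of_mem_Ioo ⟨by linarith, by linarith⟩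
  have hsk := Real.sin_sq_add_cos_sq (chordAngle p q)
  have hs2 : Real.sin (chordAngle p q) ≤ 1 / 2 := by
    rw [← Real.sin_pi_div_six]
    exact Real.sin_le_sin_of_le_of_le_pi_div_two (by linarith) (by linarith) ht1
  unfold pairTip at hT
  set e := frame (q - p) b
  set z := e.symm (x - p) with hz
  set s := Real.sin (chordAngle p q)
  set k := Real.cos (chordAngle p q)
  set d := ‖q - p‖
  have hx : x = p + e z := by rw [hz, LinearIsometryEquiv.apply_symm_apply]; ring
  -- `α` and `β` are the barycentric coordinates of `x` with respect to `q` and the tip.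
  set β := z.im / (hexRadius * s) with hβ
  set α := z.re / d - β / 2 with hα
  have hβ0 : 0 ≤ β := by positivity
  have hαd : α * d = z.re - z.im * k / s := by
    rw [hα, hβ, hd]; field_simp
  have hα0 : 0 ≤ α := by
    have : 0 ≤ α * d := by
      rw [hαd, sub_nonneg, div_le_iff₀ hs]; exact c2.le
    exact nonneg_of_mul_nonneg_left this hd0
  have hsum : α + β ≤ 1 := by
    have m1 : z.re * s + z.im * k ≤ 2 * s * k * hexRadius := by
      have m2 : k * z.re + s * z.im ≤ hexRadius := by
        have m3 : z.re ^ 2 + z.im ^ 2 ≤ hexRadius ^ 2 := by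
          have := pow_le_pow_left₀ (norm_nonneg _) c3.le 2
          rw [← Complex.normSq_eq_norm_sq, Complex.normSq_apply] at this
          linarith
        apply abs_le_of_sq_le_sq' _ hR.le |>.2
        nlinarith [sq_nonneg (s * z.re - k * z.im)]
      -- This is `cos 2θ ≥ 0`, the obtuseness of the angle at the tip.
      have m4 : 0 ≤ k ^ 2 - s ^ 2 := by nlinarith
      have m5 := mul_nonneg m4 (sub_nonneg.2 c2.le)
      have m6 : 0 ≤ 2 * s * k * (hexRadius - (k * z.re + s * z.im)) :=
        mul_nonneg (by positivity) (by linarith)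
      have m7 : z.re * s + z.im * k = 2 * s * k * (k * z.re + s * z.im) -
          (k ^ 2 - s ^ 2) * (z.re * s - z.im * k) := by
        linear_combination (-(z.re * s + z.im * k)) * hsk
      linarith
    have : α + β = (z.re * s + z.im * k) / (2 * s * k * hexRadius) := by
      rw [hα, hβ, hd]; field_simp; ring
    rw [this, div_le_one (by positivity)]
    exact m1
  have hcomb : x = (1 - α - β) • p + α • q + β • (p + e ⟨d / 2, hexRadius * s⟩) := by
    have hzz : z = (α : ℝ) • (d : ℂ) + β • (⟨d / 2, hexRadius * s⟩ : ℂ) := by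
      apply Complex.ext
      · simp only [Complex.add_re, Complex.real_smul, Complex.re_ofReal_mul, Complex.ofReal_re]
        rw [hα]; field_simp; ring
      · simp only [Complex.add_im, Complex.real_smul, Complex.im_ofReal_mul, Complex.ofReal_im]
        rw [hβ]; field_simp; ring
    rw [hx, hzz, map_add, map_smul, map_smul, hv]
    module
  rw [hcomb]
  have := hQ.sum_mem (t := Finset.univ) (w := ![1 - α - β, α, β])
    (z := ![p, q, p + e ⟨d / 2, hexRadius * s⟩])
    (by intro i _; fin_cases i
        · simp; linarith
        · exact hα0
        · exact hβ0)
    (by simp [Fin.sum_univ_three]; ring) (by intro i _; fin_cases i <;> assumption)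
  rw [Fin.sum_univ_three] at this
  exact this

/-! ### Caps cut by the sides of the square -/

theorem measurableSet_reProdIm {s t : Set ℝ} (hs : MeasurableSet s) (ht : MeasurableSet t) :
    MeasurableSet (s ×ℂ t) :=
  (Complex.measurable_re hs).inter (Complex.measurable_im ht)

theorem volume_real_reProdIm {s t : Set ℝ} (hs : MeasurableSet s) (ht : MeasurableSet t) :
    volume.real (s ×ℂ t) = volume.real s * volume.real t := by
  have h1 : s ×ℂ t = Complex.measurableEquivRealProd ⁻¹' (s ×ˢ t) := by
    ext z; simp [Complex.mem_reProdIm, Complex.measurableEquivRealProd_apply]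
  rw [h1, Complex.volume_preserving_equiv_real_prod.measureReal_preimage
    (hs.prod ht).nullMeasurableSet, Measure.volume_eq_prod, measureReal_prod_prod]

theorem volume_reProdIm_Icc_ne_top (a b c d : ℝ) : volume (Set.Icc a b ×ℂ Set.Icc c d) ≠ ⊤ := by
  have h1 : Set.Icc a b ×ℂ Set.Icc c d =
      Complex.measurableEquivRealProd ⁻¹' (Set.Icc a b ×ˢ Set.Icc c d) := by
    ext z; exact Iff.rfl
  rw [h1, Complex.volume_preserving_equiv_real_prod.measure_preimage
    (measurableSet_Icc.prod measurableSet_Icc).nullMeasurableSet]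
  exact (isCompact_Icc.prod isCompact_Icc).measure_lt_top.ne

/-- If the tip is cut off while `p` and `q` are not, the boundary line makes a bounded angle with
`pq`. What remains of the cap then fits into a box of width `hexRadius - d/2`, where `d = ‖q - p‖`,
and of height proportional to `ℓ p + ℓ q`. -/
theorem volume_real_pairCap_inter_halfPlane_le {p q : ℂ} {b : Bool} (h1 : 1 ≤ ‖q - p‖)
    (h2 : ‖q - p‖ < 2 * hexRadius) {n : ℂ} (hn : ‖n‖ = 1) {ℓ : ℂ → ℝ}
    (hℓ : ∀ x, ℓ x = ℓ p + inner ℝ n (x - p)) (hp : 0 ≤ ℓ p) (hq : 0 ≤ ℓ q)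
    (hT : ℓ (pairTip p q b) < 0) :
    ℓ p + ℓ q < hexRadius ∧
      volume.real (pairCap p q b ∩ {x | 0 ≤ ℓ x}) ≤ 3 / 40 * (ℓ p + ℓ q) := by
  have hR := hexRadius_pos
  have hR2 := hexRadius_sq
  have hRlt := hexRadius_lt
  have hpi := Real.pi_pos
  have ht0 := chordAngle_pos h2
  have ht1 := chordAngle_le h1
  have hd := norm_eq_mul_cos h1 h2
  have hd0 : 0 < ‖q - p‖ := by linarith
  have hv := frame_norm (q - p) b
  have hs : 0 < Real.sin (chordAngle p q) := Real.sin_pos_of_pos_of_lt_pi ht0 (by linarith)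
  have hs2 : Real.sin (chordAngle p q) ≤ 1 / 2 := by
    rw [← Real.sin_pi_div_six]
    exact Real.sin_le_sin_of_le_of_le_pi_div_two (by linarith) (by linarith) ht1
  set e := frame (q - p) b with he
  set m := e.symm n with hm
  have hin : ∀ z, inner ℝ n (e z) = m.re * z.re + m.im * z.im := by
    intro z
    rw [← e.apply_symm_apply n, LinearIsometryEquiv.inner_map_map, Complex.inner]
    simp only [Complex.mul_re, Complex.conj_re, Complex.conj_im]
    ring
  have hm1 : m.re ^ 2 + m.im ^ 2 = 1 := by
    have : ‖m‖ = 1 := by rw [hm, LinearIsometryEquiv.norm_map, hn]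
    have h := Complex.normSq_eq_norm_sq m
    rw [this, Complex.normSq_apply] at h
    linarith
  have hqe : ℓ q = ℓ p + m.re * ‖q - p‖ := by
    rw [hℓ q]
    congr 1
    conv_lhs => rw [← hv]
    rw [hin]; simp
  have hTe : ℓ (pairTip p q b) = ℓ p + (m.re * (‖q - p‖ / 2) +
      m.im * (hexRadius * Real.sin (chordAngle p q))) := by
    rw [hℓ (pairTip p q b)]
    congr 1
    rw [pairTip, add_sub_cancel_left, ← he, hin]
  have hmem : ∀ z, ℓ (p + e z) = ℓ p + (m.re * z.re + m.im * z.im) := by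
    intro z; rw [hℓ, add_sub_cancel_left, hin]
  rw [hTe] at hT
  set s := Real.sin (chordAngle p q)
  set d := ‖q - p‖
  set σ := -m.im with hσ
  have hσs : ℓ p + ℓ q < 2 * σ * (hexRadius * s) := by rw [hqe]; nlinarith
  have hσ0 : 0 < σ := by
    by_contra! hcon
    have : 0 < hexRadius * s := by positivity
    nlinarith
  have hσ1 : σ ≤ 1 := by nlinarith [sq_nonneg m.re]
  have hsum : ℓ p + ℓ q < hexRadius := by
    have : σ * (hexRadius * s) ≤ 1 * (hexRadius * (1 / 2)) := by gcongr
    linarith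
  -- `|m.re| d = |ℓ q - ℓ p| ≤ ℓ p + ℓ q < hexRadius` and `d ≥ 1`. Hence `σ² > 2/3`, which gives the
  -- `0.8` below.
  have hre : m.re ^ 2 < 1 / 3 := by
    have a1 : (m.re * d) ^ 2 < hexRadius ^ 2 := sq_lt_sq' (by linarith) (by linarith)
    have a2 : 1 ≤ d ^ 2 := by nlinarith
    nlinarith [sq_nonneg m.re]
  have hσ2 : 0.8 < σ := by nlinarith
  refine ⟨hsum, ?_⟩
  -- The factor exceeds `0.5774 / 0.8`: on the box `ℓ p + m.re * z.re` is at most `0.5774 (ℓ p + ℓ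
  -- q)`, and it bounds `σ * z.im`.
  set M := 0.73 * (ℓ p + ℓ q) with hM
  have hM0 : 0 ≤ M := by positivity
  have hsub : pairCap p q b ∩ {x | 0 ≤ ℓ x} ⊆ (fun x => e.symm (x - p)) ⁻¹'
      (Set.Icc (d / 2) hexRadius ×ℂ Set.Icc 0 M) := by
    rintro x ⟨⟨c1, c2, c3⟩, hx⟩
    have hxe : x = p + e (e.symm (x - p)) := by
      rw [LinearIsometryEquiv.apply_symm_apply]; ring
    rw [Set.mem_ofPred_eq, hxe, hmem] at hx
    change _ ≤ (e.symm (x - p)).re at c1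
    change 0 ≤ (e.symm (x - p)).im at c2
    change ‖e.symm (x - p)‖ < _ at c3
    rw [Set.mem_preimage, Complex.mem_reProdIm]
    set z := e.symm (x - p)
    have hz : z.re ≤ hexRadius := (Complex.re_le_norm z).trans c3.le
    have hz2 : d / 2 ≤ z.re := by rw [hd]; linarith
    refine ⟨⟨hz2, hz⟩, c2, ?_⟩
    have k1 : σ * z.im ≤ ℓ p + m.re * z.re := by linarith
    have k2 : (ℓ p + m.re * z.re) * d = ℓ p * (d - z.re) + ℓ q * z.re := by rw [hqe]; ring
    have k3 : (ℓ p + m.re * z.re) * d ≤ 0.5774 * (ℓ p + ℓ q) * d := by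
      rw [k2]
      have : ℓ p * (d - z.re) ≤ ℓ p * (0.5774 * d) := by gcongr; linarith
      have : ℓ q * z.re ≤ ℓ q * (0.5774 * d) := by gcongr; linarith
      linarith
    have k4 := le_of_mul_le_mul_right k3 hd0
    have k5 : 0.8 * z.im ≤ σ * z.im := by gcongr
    rw [hM]; linarith
  have hbox : MeasurableSet (Set.Icc (d / 2) hexRadius ×ℂ Set.Icc 0 M) :=
    measurableSet_reProdIm measurableSet_Icc measurableSet_Icc
  have hmp := measurePreserving_frame_symm p (q - p) b
  calc volume.real (pairCap p q b ∩ {x | 0 ≤ ℓ x})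
      ≤ volume.real ((fun x => e.symm (x - p)) ⁻¹'
        (Set.Icc (d / 2) hexRadius ×ℂ Set.Icc 0 M)) := by
        refine measureReal_mono hsub ?_
        rw [hmp.measure_preimage hbox.nullMeasurableSet]
        exact volume_reProdIm_Icc_ne_top _ _ _ _
    _ = (hexRadius - d / 2) * M := by
        rw [hmp.measureReal_preimage hbox.nullMeasurableSet,
          volume_real_reProdIm measurableSet_Icc measurableSet_Icc,
          Real.volume_real_Icc_of_le (by linarith), Real.volume_real_Icc_of_le hM0, sub_zero]
    _ ≤ 0.0774 * M := by gcongr; linarith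
    _ ≤ _ := by rw [hM]; linarith

/-- The points `p`, `q` and the two tips form a rhombus. For a wall this forces at most one tip of a
pair to lie beyond it. -/
theorem add_pairTip_eq {p q : ℂ} {n : ℂ} {ℓ : ℂ → ℝ}
    (hℓ : ∀ x, ℓ x = ℓ p + inner ℝ n (x - p)) :
    ℓ (pairTip p q false) + ℓ (pairTip p q true) = ℓ p + ℓ q := by
  have h : (pairTip p q false - p) + (pairTip p q true - p) = q - p := by
    unfold pairTip
    rw [add_sub_cancel_left, add_sub_cancel_left, show true = !false from rfl, frame_not,
      ← map_add]
    conv_rhs => rw [← frame_norm (q - p) false]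
    congr 1
    apply Complex.ext <;> simp
  rw [hℓ (pairTip p q false), hℓ (pairTip p q true), hℓ q, ← h, inner_add_right]
  ring

/-- The distances of a point from the four sides of the square `[0, t] × [0, t]`. -/
def wall (t : ℝ) (k : Fin 4) (x : ℂ) : ℝ := ![x.re, t - x.re, x.im, t - x.im] k

def wallNormal (k : Fin 4) : ℂ := ![1, -1, Complex.I, -Complex.I] k

theorem norm_wallNormal (k : Fin 4) : ‖wallNormal k‖ = 1 := by
  fin_cases k <;> simp [wallNormal]

theorem wall_eq (t : ℝ) (k : Fin 4) (p x : ℂ) :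
    wall t k x = wall t k p + inner ℝ (wallNormal k) (x - p) := by
  fin_cases k <;> simp [wall, wallNormal, Complex.inner]

/-- The square `[0, t] × [0, t]` in the complex plane. -/
def complexSquare (t : ℝ) : Set ℂ := Set.Icc 0 t ×ℂ Set.Icc 0 t

theorem mem_complexSquare_iff {t : ℝ} {x : ℂ} :
    x ∈ complexSquare t ↔ ∀ k, 0 ≤ wall t k x := by
  simp [complexSquare, Complex.mem_reProdIm, wall, Fin.forall_fin_succ, and_assoc]

theorem convex_complexSquare (t : ℝ) : Convex ℝ (complexSquare t) :=
  ((convex_Icc 0 t).is_linear_preimage Complex.reCLM.isLinear).inter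
    ((convex_Icc 0 t).is_linear_preimage Complex.imCLM.isLinear)

theorem measurableSet_complexSquare (t : ℝ) : MeasurableSet (complexSquare t) :=
  measurableSet_reProdIm measurableSet_Icc measurableSet_Icc

theorem volume_complexSquare_ne_top (t : ℝ) : volume (complexSquare t) ≠ ⊤ :=
  volume_reProdIm_Icc_ne_top _ _ _ _

theorem volume_real_complexSquare {t : ℝ} (ht : 0 ≤ t) : volume.real (complexSquare t) = t ^ 2 := by
  rw [complexSquare, volume_real_reProdIm measurableSet_Icc measurableSet_Icc,
    Real.volume_real_Icc_of_le ht]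
  ring

-- If the tip is inside, the sector is not cut and the bound for whole caps applies. Otherwise one
-- wall that cuts off the tip suffices, and the other summands are nonnegative.
open Classical in
theorem volume_real_pairCap_inter_square_le {t : ℝ} {p q : ℂ} (b : Bool) (h1 : 1 ≤ ‖q - p‖)
    (h2 : ‖q - p‖ < 2 * hexRadius) (hp : p ∈ complexSquare t) (hq : q ∈ complexSquare t) :
    volume.real (pairCap p q b ∩ complexSquare t) ≤
      (1 - 3 * √3 / (2 * Real.pi)) * volume.real (pairSector p q b ∩ complexSquare t) +
      ∑ k, if wall t k (pairTip p q b) < 0 then 3 / 40 * (wall t k p + wall t k q) else 0 := by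
  have hp' := mem_complexSquare_iff.1 hp
  have hq' := mem_complexSquare_iff.1 hq
  have hnn : ∀ k ∈ Finset.univ, 0 ≤ if wall t k (pairTip p q b) < 0 then
      3 / 40 * (wall t k p + wall t k q) else 0 := by
    intro k _
    have := hp' k
    have := hq' k
    split_ifs <;> positivity
  have hc : 0 ≤ 1 - 3 * √3 / (2 * Real.pi) := by
    rw [sub_nonneg, div_le_one (by positivity)]
    have h3 : √3 ≤ 1.74 := by rw [Real.sqrt_le_left (by norm_num)]; norm_num
    linarith [Real.pi_gt_three]
  by_cases hT : pairTip p q b ∈ complexSquare t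
  · have hsub := pairSector_subset_of_tip_mem (convex_complexSquare t) h1 h2 hp hq hT
    rw [Set.inter_eq_left.2 hsub]
    have := Finset.sum_nonneg hnn
    have h3 := volume_real_pairCap_le h1 h2 b
    have h4 : volume.real (pairCap p q b ∩ complexSquare t) ≤ volume.real (pairCap p q b) :=
      measureReal_mono Set.inter_subset_left
        (measure_ne_top_of_subset (pairCap_subset_ball p q b) measure_ball_lt_top.ne)
    linarith
  · rw [mem_complexSquare_iff] at hT
    push Not at hT
    obtain ⟨k, hk⟩ := hT
    have h3 := (volume_real_pairCap_inter_halfPlane_le (b := b) h1 h2 (norm_wallNormal k)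
      (wall_eq t k p) (hp' k) (hq' k) hk).2
    have h4 := Finset.single_le_sum hnn (Finset.mem_univ k)
    rw [if_pos hk] at h4
    have h5 : volume.real (pairCap p q b ∩ complexSquare t) ≤
        volume.real (pairCap p q b ∩ {x | 0 ≤ wall t k x}) :=
      measureReal_mono
        (Set.inter_subset_inter_right _ fun x hx => mem_complexSquare_iff.1 hx k)
        (measure_ne_top_of_subset (Set.inter_subset_left.trans (pairCap_subset_ball p q b))
          measure_ball_lt_top.ne)
    have h6 : 0 ≤ (1 - 3 * √3 / (2 * Real.pi)) *
      volume.real (pairSector p q b ∩ complexSquare t) := mul_nonneg hc measureReal_nonneg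
    linarith

/-! ### The area count over all disks -/

open Classical in
/-- The indices of the points at distance less than `2 * hexRadius` from the `i`-th point. -/
noncomputable def neighbors {ι : Type*} [Fintype ι] (c : ι → ℂ) (i : ι) : Finset ι :=
  {j | j ≠ i ∧ ‖c j - c i‖ < 2 * hexRadius}

theorem mem_neighbors {ι : Type*} [Fintype ι] {c : ι → ℂ} {i j : ι} :
    j ∈ neighbors c i ↔ j ≠ i ∧ ‖c j - c i‖ < 2 * hexRadius := by
  simp [neighbors]

/-- Let `c i₀` be a center nearest to `x`. Any other disk containing `x` has `x` in its cap towards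
`c i₀`, so only the disk of `i₀` can remain uncovered by caps. -/
theorem sum_indicator_ball_le {ι : Type*} [Fintype ι] {c : ι → ℂ}
    (hc : ∀ i j, i ≠ j → 1 ≤ ‖c j - c i‖) (x : ℂ) :
    ∑ i, (Metric.ball (c i) hexRadius).indicator (1 : ℂ → ℝ) x ≤
      1 + ∑ i, ∑ j ∈ neighbors c i, ∑ b, (pairCap (c i) (c j) b).indicator (1 : ℂ → ℝ) x := by
  classical
  have hnn : ∀ i j b, 0 ≤ (pairCap (c i) (c j) b).indicator (1 : ℂ → ℝ) x :=
    fun i j b => Set.indicator_nonneg (fun _ _ => zero_le_one) x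
  have hrow : ∀ i, 0 ≤ ∑ j ∈ neighbors c i, ∑ b,
      (pairCap (c i) (c j) b).indicator (1 : ℂ → ℝ) x :=
    fun i => Finset.sum_nonneg fun j _ => Finset.sum_nonneg fun b _ => hnn i j b
  rcases isEmpty_or_nonempty ι with hι | hι
  · simp
  obtain ⟨i₀, -, h₀⟩ := Finset.exists_min_image Finset.univ (fun i => dist x (c i))
    Finset.univ_nonempty
  have hi : ∀ i, (Metric.ball (c i) hexRadius).indicator (1 : ℂ → ℝ) x ≤
      (if i = i₀ then 1 else 0) + ∑ j ∈ neighbors c i, ∑ b,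
        (pairCap (c i) (c j) b).indicator (1 : ℂ → ℝ) x := by
    intro i
    by_cases hx : x ∈ Metric.ball (c i) hexRadius
    swap
    · rw [Set.indicator_of_notMem hx]
      have := hrow i
      split_ifs <;> linarith
    rw [Set.indicator_of_mem hx]
    by_cases hii : i = i₀
    · rw [if_pos hii]
      have := hrow i
      simp only [Pi.one_apply]; linarith
    obtain ⟨h2, b, hb⟩ := mem_pairCap_of_dist_le (hc i i₀ hii) hx (h₀ i (Finset.mem_univ i))
    have hmem : i₀ ∈ neighbors c i := mem_neighbors.2 ⟨Ne.symm hii, h2⟩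
    have h3 := Finset.single_le_sum (f := fun j => ∑ b,
      (pairCap (c i) (c j) b).indicator (1 : ℂ → ℝ) x)
      (fun j _ => Finset.sum_nonneg fun b _ => hnn i j b) hmem
    have h4 := Finset.single_le_sum (f := fun b =>
      (pairCap (c i) (c i₀) b).indicator (1 : ℂ → ℝ) x) (fun b _ => hnn i i₀ b)
      (Finset.mem_univ b)
    simp only [Set.indicator_of_mem hb, Pi.one_apply] at h3 h4 ⊢
    rw [if_neg hii]
    linarith
  calc _ ≤ ∑ i, ((if i = i₀ then (1 : ℝ) else 0) + ∑ j ∈ neighbors c i, ∑ b,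
        (pairCap (c i) (c j) b).indicator (1 : ℂ → ℝ) x) := Finset.sum_le_sum fun i _ => hi i
    _ = _ := by rw [Finset.sum_add_distrib]; simp

theorem sum_volume_ball_inter_le {ι : Type*} [Fintype ι] {c : ι → ℂ}
    (hc : ∀ i j, i ≠ j → 1 ≤ ‖c j - c i‖) {Q : Set ℂ} (hQ : volume Q ≠ ⊤) :
    ∑ i, volume.real (Metric.ball (c i) hexRadius ∩ Q) ≤ volume.real Q +
      ∑ i, ∑ j ∈ neighbors c i, ∑ b, volume.real (pairCap (c i) (c j) b ∩ Q) := by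
  have : IsFiniteMeasure (volume.restrict Q) := isFiniteMeasure_restrict.2 hQ
  have hvol : ∀ {s : Set ℂ}, MeasurableSet s →
      volume.real (s ∩ Q) = ∫ x, s.indicator (1 : ℂ → ℝ) x ∂(volume.restrict Q) := by
    intro s hs
    rw [integral_indicator_one hs, measureReal_restrict_apply hs]
  have hint : ∀ {s : Set ℂ}, MeasurableSet s →
      Integrable (fun x => s.indicator (1 : ℂ → ℝ) x) (volume.restrict Q) :=
    fun hs => (integrable_const (1 : ℝ)).indicator hs
  have hball : ∀ i, MeasurableSet (Metric.ball (c i) hexRadius) := fun i => measurableSet_ball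
  have hcap : ∀ i j b, MeasurableSet (pairCap (c i) (c j) b) :=
    fun i j b => measurableSet_pairCap _ _ _
  simp only [hvol (hball _), hvol (hcap _ _ _)]
  have h1 : volume.real Q = ∫ _, (1 : ℝ) ∂(volume.restrict Q) := by simp
  rw [h1]
  simp_rw [← integral_finsetSum _ (fun b _ => hint (hcap _ _ b))]
  have hint2 : ∀ i j, Integrable
      (fun x => ∑ b, (pairCap (c i) (c j) b).indicator (1 : ℂ → ℝ) x) (volume.restrict Q) :=
    fun i j => integrable_finsetSum _ fun b _ => hint (hcap i j b)
  have hint3 : ∀ i, Integrable (fun x => ∑ j ∈ neighbors c i, ∑ b,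
      (pairCap (c i) (c j) b).indicator (1 : ℂ → ℝ) x) (volume.restrict Q) :=
    fun i => integrable_finsetSum _ fun j _ => hint2 i j
  have e1 : ∀ i, ∑ j ∈ neighbors c i, ∫ x, ∑ b,
      (pairCap (c i) (c j) b).indicator (1 : ℂ → ℝ) x ∂(volume.restrict Q) =
      ∫ x, ∑ j ∈ neighbors c i, ∑ b,
      (pairCap (c i) (c j) b).indicator (1 : ℂ → ℝ) x ∂(volume.restrict Q) :=
    fun i => (integral_finsetSum _ fun j _ => hint2 i j).symm
  simp_rw [e1]
  rw [← integral_finsetSum _ (fun i _ => hint3 i), ← integral_finsetSum _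
    (fun i _ => hint (hball i)), ← integral_add (integrable_const _)
    (integrable_finsetSum _ fun i _ => hint3 i)]
  exact integral_mono (integrable_finsetSum _ fun i _ => hint (hball i))
    ((integrable_const _).add (integrable_finsetSum _ fun i _ => hint3 i))
    (fun x => sum_indicator_ball_le hc x)

theorem sum_volume_pairSector_le {ι : Type*} [Fintype ι] {c : ι → ℂ}
    (hc : ∀ i j, i ≠ j → 1 ≤ ‖c j - c i‖) {Q : Set ℂ} (hQ : MeasurableSet Q) (i : ι) :
    ∑ j ∈ neighbors c i, ∑ b, volume.real (pairSector (c i) (c j) b ∩ Q) ≤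
      volume.real (Metric.ball (c i) hexRadius ∩ Q) := by
  classical
  rw [← Finset.sum_product' (s := neighbors c i) (t := Finset.univ)
    (f := fun j b => volume.real (pairSector (c i) (c j) b ∩ Q))]
  have hfin : volume (Metric.ball (c i) hexRadius ∩ Q) ≠ ⊤ :=
    measure_ne_top_of_subset Set.inter_subset_left measure_ball_lt_top.ne
  have hsub : ∀ j b, pairSector (c i) (c j) b ∩ Q ⊆ Metric.ball (c i) hexRadius ∩ Q :=
    fun j b => Set.inter_subset_inter_left _ (pairSector_subset_ball _ _ _)
  rw [← measureReal_biUnion_finset (μ := volume)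
    (f := fun x : ι × Bool => pairSector (c i) (c x.1) x.2 ∩ Q)
    (h := fun x _ => measure_ne_top_of_subset (hsub _ _) hfin)]
  · exact measureReal_mono (Set.iUnion₂_subset fun x _ => hsub _ _) hfin
  · rintro ⟨j, b⟩ hj ⟨j', b'⟩ hj' hne
    simp only [Finset.coe_product, Set.mem_prod, Finset.mem_coe, mem_neighbors] at hj hj'
    refine Disjoint.mono Set.inter_subset_left Set.inter_subset_left ?_
    by_cases hjj : j = j'
    · subst hjj
      have hb : b' = !b := by
        cases b <;> cases b' <;> simp_all
      subst hb
      exact disjoint_pairSector_not _ _ _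
    · exact disjoint_pairSector (hc i j hj.1.1.symm) (hc i j' hj'.1.1.symm) (hc j j' hjj)
        hj.1.2 hj'.1.2 b b'
  · exact fun x _ => (measurableSet_pairSector _ _ _).inter hQ

-- The disks exceed the square by at most the caps, and the caps at one center are at most `1 -
-- 3√3/(2π)` times the disk part plus errors, since the sectors there are disjoint. Absorbing that
-- multiple on the left leaves the factor `3√3/(2π)`.
open Classical in
theorem sum_volume_ball_inter_square_le {ι : Type*} [Fintype ι] {c : ι → ℂ} {t : ℝ}
    (ht : 0 ≤ t) (hc : ∀ i j, i ≠ j → 1 ≤ ‖c j - c i‖) (hQ : ∀ i, c i ∈ complexSquare t) :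
    3 * √3 / (2 * Real.pi) * ∑ i, volume.real (Metric.ball (c i) hexRadius ∩ complexSquare t) ≤
      t ^ 2 + ∑ i, ∑ j ∈ neighbors c i, ∑ b, ∑ k,
        if wall t k (pairTip (c i) (c j) b) < 0 then
          3 / 40 * (wall t k (c i) + wall t k (c j)) else 0 := by
  have h1 := sum_volume_ball_inter_le hc (volume_complexSquare_ne_top t)
  rw [volume_real_complexSquare ht] at h1
  have hc0 : 0 ≤ 1 - 3 * √3 / (2 * Real.pi) := by
    rw [sub_nonneg, div_le_one (by positivity)]
    have h3 : √3 ≤ 1.74 := by rw [Real.sqrt_le_left (by norm_num)]; norm_num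
    linarith [Real.pi_gt_three]
  have h2 : ∑ i, ∑ j ∈ neighbors c i, ∑ b, volume.real (pairCap (c i) (c j) b ∩ complexSquare t)
      ≤ ∑ i, ((1 - 3 * √3 / (2 * Real.pi)) *
        volume.real (Metric.ball (c i) hexRadius ∩ complexSquare t) +
        ∑ j ∈ neighbors c i, ∑ b, ∑ k,
        if wall t k (pairTip (c i) (c j) b) < 0 then
          3 / 40 * (wall t k (c i) + wall t k (c j)) else 0) := by
    refine Finset.sum_le_sum fun i _ => ?_
    refine le_trans ?_ (add_le_add_left (mul_le_mul_of_nonneg_left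
      (sum_volume_pairSector_le hc (measurableSet_complexSquare t) i) hc0) _)
    simp only [Finset.mul_sum, ← Finset.sum_add_distrib]
    refine Finset.sum_le_sum fun j hj => Finset.sum_le_sum fun b _ => ?_
    obtain ⟨hj1, hj2⟩ := mem_neighbors.1 hj
    exact volume_real_pairCap_inter_square_le b (hc i j hj1.symm) hj2 (hQ i) (hQ j)
  rw [Finset.sum_add_distrib, ← Finset.mul_sum] at h2
  linarith

/-! ### Charging the errors to points near a side -/

/-- The coordinate of a point along the sides of the square. -/
def wallCoord (k : Fin 4) (x : ℂ) : ℝ := ![x.im, x.im, x.re, x.re] k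

theorem norm_sub_sq_eq_wall (t : ℝ) (k : Fin 4) (p q : ℂ) :
    ‖q - p‖ ^ 2 = (wallCoord k p - wallCoord k q) ^ 2 + (wall t k p - wall t k q) ^ 2 := by
  rw [← Complex.normSq_eq_norm_sq, Complex.normSq_apply]
  fin_cases k <;> simp [wall, wallCoord] <;> ring

open Classical in
theorem card_partners_le_two {ι : Type*} [Fintype ι] {τ h : ι → ℝ} (hh : ∀ i, 0 ≤ h i)
    (hsep : ∀ i j, i ≠ j → 1 ≤ (τ i - τ j) ^ 2 + (h i - h j) ^ 2) (i : ι) :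
    (Finset.univ.filter fun j => j ≠ i ∧ (τ i - τ j) ^ 2 + (h i - h j) ^ 2 < 4 / 3 ∧
      h i + h j < hexRadius).card ≤ 2 := by
  set P := Finset.univ.filter fun j => j ≠ i ∧ (τ i - τ j) ^ 2 + (h i - h j) ^ 2 < 4 / 3 ∧
      h i + h j < hexRadius with hP
  have hR := hexRadius_sq
  have hR0 := hexRadius_pos
  -- The heights differ by at most `hexRadius`, so the squared distance along the side lies between
  -- `1 - 1/3` and `4/3 = (2 * hexRadius)²`.
  have hfar : ∀ j ∈ P, 0.816 ≤ |τ i - τ j| ∧ |τ i - τ j| ≤ 1.155 ∧ h j < hexRadius := by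
    intro j hj
    simp only [hP, Finset.mem_filter, Finset.mem_univ, true_and] at hj
    obtain ⟨h1, h2, h3⟩ := hj
    have h4 : (h i - h j) ^ 2 ≤ hexRadius ^ 2 :=
      sq_le_sq' (by linarith [hh i]) (by linarith [hh j])
    have h5 := hsep i j h1.symm
    refine ⟨?_, ?_, by linarith [hh i]⟩
    · apply le_of_sq_le_sq _ (abs_nonneg _)
      rw [sq_abs]; norm_num; linarith
    · apply abs_le_of_sq_le_sq _ (by norm_num)
      nlinarith [sq_nonneg (h i - h j)]
  -- Two partners on the same side of `i` have coordinates differing by at most `1.155 - 0.816 =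
  -- 0.339`, and `0.339² + 1/3 < 1`.
  have hclose : ∀ j ∈ P, ∀ j' ∈ P, |τ j - τ j'| ≤ 0.339 → j = j' := by
    intro j hj j' hj' hd
    by_contra hne
    have h1 := hsep j j' hne
    have h2 : (τ j - τ j') ^ 2 ≤ 0.339 ^ 2 := by
      rw [← sq_abs]; exact pow_le_pow_left₀ (abs_nonneg _) hd 2
    have h3 : (h j - h j') ^ 2 ≤ hexRadius ^ 2 :=
      sq_le_sq' (by linarith [hh j, (hfar j' hj').2.2]) (by linarith [hh j', (hfar j hj).2.2])
    norm_num at h2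
    linarith
  have hsplit : P = P.filter (fun j => τ j < τ i) ∪ P.filter (fun j => ¬ τ j < τ i) :=
    (Finset.filter_union_filter_not_eq _ _).symm
  rw [hsplit]
  refine (Finset.card_union_le _ _).trans ?_
  have hc1 : (P.filter (fun j => τ j < τ i)).card ≤ 1 := by
    refine Finset.card_le_one.2 fun j hj j' hj' => ?_
    obtain ⟨a1, a2⟩ := Finset.mem_filter.1 hj
    obtain ⟨a3, a4⟩ := Finset.mem_filter.1 hj'
    refine hclose j a1 j' a3 ?_
    obtain ⟨b1, b2, -⟩ := hfar j a1
    obtain ⟨b3, b4, -⟩ := hfar j' a3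
    rw [abs_of_pos (by linarith)] at b1 b2 b3 b4
    rw [abs_le]; constructor <;> linarith
  have hc2 : (P.filter (fun j => ¬ τ j < τ i)).card ≤ 1 := by
    refine Finset.card_le_one.2 fun j hj j' hj' => ?_
    obtain ⟨a1, a2⟩ := Finset.mem_filter.1 hj
    obtain ⟨a3, a4⟩ := Finset.mem_filter.1 hj'
    refine hclose j a1 j' a3 ?_
    obtain ⟨b1, b2, -⟩ := hfar j a1
    obtain ⟨b3, b4, -⟩ := hfar j' a3
    rw [abs_of_nonpos (by linarith)] at b1 b2 b3 b4
    rw [abs_le]; constructor <;> linarith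
  omega

-- The relation is symmetric, so both summands contribute equally, and each `h i` occurs at most
-- twice in either.
open Classical in
theorem sum_partners_le {ι : Type*} [Fintype ι] {τ h : ι → ℝ} (hh : ∀ i, 0 ≤ h i)
    (hsep : ∀ i j, i ≠ j → 1 ≤ (τ i - τ j) ^ 2 + (h i - h j) ^ 2) :
    ∑ i, ∑ j with j ≠ i ∧ (τ i - τ j) ^ 2 + (h i - h j) ^ 2 < 4 / 3 ∧ h i + h j < hexRadius,
      (h i + h j) ≤ 4 * ∑ i, if h i < hexRadius then h i else 0 := by
  set P : ι → ι → Prop := fun i j =>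
    j ≠ i ∧ (τ i - τ j) ^ 2 + (h i - h j) ^ 2 < 4 / 3 ∧ h i + h j < hexRadius with hP
  have hsymm : ∀ i j, P i j ↔ P j i := by
    intro i j
    simp only [hP, ne_comm (a := i), add_comm (h i)]
    rw [← neg_sub (τ j), ← neg_sub (h j), neg_sq, neg_sq]
  have h1 : ∑ i, ∑ j with P i j, h j = ∑ i, ∑ j with P i j, h i := by
    simp only [Finset.sum_filter]
    rw [Finset.sum_comm]
    simp only [hsymm]
  have h2 : ∀ i, ∑ j with P i j, h i ≤ 2 * if h i < hexRadius then h i else 0 := by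
    intro i
    have hcard := card_partners_le_two hh hsep i
    rw [Finset.sum_const, nsmul_eq_mul]
    split_ifs with hi
    · exact mul_le_mul_of_nonneg_right (by exact_mod_cast hcard) (hh i)
    · have : Finset.univ.filter (P i) = ∅ := by
        refine Finset.filter_eq_empty_iff.2 fun j _ hj => hi ?_
        linarith [hj.2.2, hh j]
      rw [this]; simp
  have h3 : ∑ i, ∑ j with P i j, h i ≤ ∑ i, 2 * if h i < hexRadius then h i else 0 :=
    Finset.sum_le_sum fun i _ => h2 i
  rw [← Finset.mul_sum] at h3
  simp only [Finset.sum_add_distrib]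
  linarith

-- For each wall at most one of the two tips of a pair is outside, and then the pair consists of
-- partners in the sense of `card_partners_le_two`. The constant is `3/40 · 4`.
open Classical in
theorem sum_outside_tips_le {ι : Type*} [Fintype ι] {c : ι → ℂ} {t : ℝ}
    (hc : ∀ i j, i ≠ j → 1 ≤ ‖c j - c i‖) (hQ : ∀ i, c i ∈ complexSquare t) :
    ∑ i, ∑ j ∈ neighbors c i, ∑ b, ∑ k, (if wall t k (pairTip (c i) (c j) b) < 0 then
          3 / 40 * (wall t k (c i) + wall t k (c j)) else 0) ≤
      3 / 10 * ∑ k, ∑ i, if wall t k (c i) < hexRadius then wall t k (c i) else 0 := by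
  have hnn : ∀ k i, 0 ≤ wall t k (c i) := fun k i => mem_complexSquare_iff.1 (hQ i) k
  have hR := hexRadius_sq
  have hR0 := hexRadius_pos
  have h1 : ∀ i, ∀ j ∈ neighbors c i, ∀ k,
      ∑ b, (if wall t k (pairTip (c i) (c j) b) < 0 then
        3 / 40 * (wall t k (c i) + wall t k (c j)) else 0) ≤
      if (j ≠ i ∧ (wallCoord k (c i) - wallCoord k (c j)) ^ 2 +
        (wall t k (c i) - wall t k (c j)) ^ 2 < 4 / 3 ∧
        wall t k (c i) + wall t k (c j) < hexRadius) then
        3 / 40 * (wall t k (c i) + wall t k (c j)) else 0 := by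
    intro i j hj k
    obtain ⟨hj1, hj2⟩ := mem_neighbors.1 hj
    have hsum := add_pairTip_eq (p := c i) (q := c j) (wall_eq t k (c i))
    have hi := hnn k i
    have hj := hnn k j
    have himp : ∀ b, wall t k (pairTip (c i) (c j) b) < 0 →
        wall t k (c i) + wall t k (c j) < hexRadius := fun b hb =>
      (volume_real_pairCap_inter_halfPlane_le (hc i j hj1.symm) hj2 (norm_wallNormal k)
        (wall_eq t k (c i)) hi hj hb).1
    have hd : (wallCoord k (c i) - wallCoord k (c j)) ^ 2 +
        (wall t k (c i) - wall t k (c j)) ^ 2 < 4 / 3 := by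
      rw [← norm_sub_sq_eq_wall]
      have := pow_lt_pow_left₀ hj2 (norm_nonneg _) two_ne_zero
      linarith [mul_pow 2 hexRadius 2]
    have hpos : 0 ≤ 3 / 40 * (wall t k (c i) + wall t k (c j)) := by positivity
    rw [Fintype.sum_bool]
    by_cases ht : wall t k (pairTip (c i) (c j) true) < 0
    · have hf : ¬ wall t k (pairTip (c i) (c j) false) < 0 := fun hf => by linarith
      rw [if_pos ht, if_neg hf, if_pos ⟨hj1, hd, himp _ ht⟩]
      linarith
    · rw [if_neg ht, zero_add]
      by_cases hf : wall t k (pairTip (c i) (c j) false) < 0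
      · rw [if_pos hf, if_pos ⟨hj1, hd, himp _ hf⟩]
      · rw [if_neg hf]; split_ifs <;> linarith
  have h2 : ∀ k, ∑ i, ∑ j ∈ neighbors c i, ∑ b,
      (if wall t k (pairTip (c i) (c j) b) < 0 then
        3 / 40 * (wall t k (c i) + wall t k (c j)) else 0) ≤
      3 / 10 * ∑ i, if wall t k (c i) < hexRadius then wall t k (c i) else 0 := by
    intro k
    have h3 := sum_partners_le (τ := fun i => wallCoord k (c i)) (h := fun i => wall t k (c i))
      (hnn k) (fun i j hij => by
        rw [← norm_sub_sq_eq_wall]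
        have := hc i j hij
        nlinarith)
    calc _ ≤ ∑ i, ∑ j ∈ neighbors c i, if (j ≠ i ∧
          (wallCoord k (c i) - wallCoord k (c j)) ^ 2 +
          (wall t k (c i) - wall t k (c j)) ^ 2 < 4 / 3 ∧
          wall t k (c i) + wall t k (c j) < hexRadius) then
          3 / 40 * (wall t k (c i) + wall t k (c j)) else 0 :=
          Finset.sum_le_sum fun i _ => Finset.sum_le_sum fun j hj => h1 i j hj k
      _ ≤ ∑ i, ∑ j, if (j ≠ i ∧
          (wallCoord k (c i) - wallCoord k (c j)) ^ 2 +
          (wall t k (c i) - wall t k (c j)) ^ 2 < 4 / 3 ∧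
          wall t k (c i) + wall t k (c j) < hexRadius) then
          3 / 40 * (wall t k (c i) + wall t k (c j)) else 0 := by
          refine Finset.sum_le_sum fun i _ => Finset.sum_le_sum_of_subset_of_nonneg
            (Finset.subset_univ _) fun j _ _ => ?_
          have := hnn k i
          have := hnn k j
          split_ifs <;> positivity
      _ = 3 / 40 * ∑ i, ∑ j with (j ≠ i ∧
          (wallCoord k (c i) - wallCoord k (c j)) ^ 2 +
          (wall t k (c i) - wall t k (c j)) ^ 2 < 4 / 3 ∧
          wall t k (c i) + wall t k (c j) < hexRadius),
          (wall t k (c i) + wall t k (c j)) := by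
          simp only [Finset.sum_filter, Finset.mul_sum, mul_ite, mul_zero]
      _ ≤ _ := by linarith
  calc _ = ∑ k, ∑ i, ∑ j ∈ neighbors c i, ∑ b,
      (if wall t k (pairTip (c i) (c j) b) < 0 then
        3 / 40 * (wall t k (c i) + wall t k (c j)) else 0) := by
        rw [Finset.sum_comm (s := (Finset.univ : Finset (Fin 4)))]
        refine Finset.sum_congr rfl fun i _ => ?_
        rw [Finset.sum_comm (s := (Finset.univ : Finset (Fin 4)))]
        refine Finset.sum_congr rfl fun j _ => ?_
        rw [Finset.sum_comm]
    _ ≤ _ := by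
        rw [Finset.mul_sum]
        exact Finset.sum_le_sum fun k _ => h2 k

/-! ### The disk area inside the square, by quadrants -/

/-- The part of the first quadrant of the disk of radius `hexRadius` around the origin that lies
in the rectangle `[0, a] × [0, b]`. -/
def quarterDisk (a b : ℝ) : Set ℂ :=
  {z | 0 < z.re ∧ z.re ≤ a ∧ 0 < z.im ∧ z.im ≤ b ∧ ‖z‖ < hexRadius}

theorem measurableSet_quarterDisk (a b : ℝ) : MeasurableSet (quarterDisk a b) :=
  (measurableSet_lt measurable_const Complex.measurable_re).inter
    ((measurableSet_le Complex.measurable_re measurable_const).inter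
    ((measurableSet_lt measurable_const Complex.measurable_im).inter
    ((measurableSet_le Complex.measurable_im measurable_const).inter
    (measurableSet_lt measurable_norm measurable_const))))

theorem volume_quarterDisk_ne_top (a b : ℝ) : volume (quarterDisk a b) ≠ ⊤ :=
  volume_ne_top_of_norm_lt fun _ hz => hz.2.2.2.2

theorem le_volume_real_quarterDisk {a b : ℝ} (ha : hexRadius ≤ a) (hb : hexRadius ≤ b) :
    Real.pi / 12 ≤ volume.real (quarterDisk a b) := by
  have hpi := Real.pi_pos
  have h1 := volume_real_sector (R := hexRadius) (θ := Real.pi / 2) hexRadius_pos.le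
    (by positivity) (by linarith)
  rw [hexRadius_sq] at h1
  have h2 : Real.pi / 12 = 1 / 3 * (Real.pi / 2) / 2 := by ring
  rw [h2, ← h1]
  refine measureReal_mono ?_ (volume_quarterDisk_ne_top a b)
  rintro z ⟨h3, h4, h5⟩
  have hz : z ≠ 0 := by rintro rfl; simp at h3
  have hre : 0 < z.re := by
    rcases Complex.abs_arg_lt_pi_div_two_iff.1 (abs_lt.2 ⟨by linarith, h4⟩) with h | h
    · exact h
    · exact absurd h hz
  have him : 0 < z.im := by
    refine lt_of_le_of_ne (Complex.arg_nonneg_iff.1 h3.le) fun h => ?_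
    exact h3.ne' (Complex.arg_eq_zero_iff.2 ⟨hre.le, h.symm⟩)
  have n1 := Complex.re_le_norm z
  have n2 := Complex.im_le_norm z
  exact ⟨hre, by linarith, him, by linarith, h5⟩

/-- The linear map scaling the imaginary part by `l`. -/
def scaleIm (l : ℝ) : ℂ →ₗ[ℝ] ℂ where
  toFun z := ⟨z.re, l * z.im⟩
  map_add' x y := by apply Complex.ext <;> simp; ring
  map_smul' c x := by apply Complex.ext <;> simp; ring

theorem det_scaleIm (l : ℝ) : LinearMap.det (scaleIm l) = l := by
  rw [← LinearMap.det_toMatrix Complex.basisOneI, Matrix.det_fin_two]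
  simp [LinearMap.toMatrix_apply, scaleIm]

/-- Compressing the full quarter disk vertically by the factor `b / hexRadius = √3 b` moves it into
the strip of height `b` without leaving the disk. -/
theorem le_volume_real_quarterDisk_strip {a b : ℝ} (ha : hexRadius ≤ a) (hb0 : 0 ≤ b)
    (hb : b ≤ hexRadius) : √3 * b * (Real.pi / 12) ≤ volume.real (quarterDisk a b) := by
  have hR := hexRadius_pos
  rcases hb0.eq_or_lt with rfl | hb0
  · simp
  have hl : √3 * b = b / hexRadius := by unfold hexRadius; field_simp
  set l := √3 * b
  have hl0 : 0 < l := by rw [hl]; positivity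
  have hl1 : l ≤ 1 := by rw [hl]; exact div_le_one_of_le₀ hb hR.le
  have h1 := Measure.addHaar_image_linearMap volume (scaleIm l) (quarterDisk hexRadius hexRadius)
  rw [det_scaleIm, abs_of_pos hl0] at h1
  have h2 : volume.real (scaleIm l '' quarterDisk hexRadius hexRadius) =
      l * volume.real (quarterDisk hexRadius hexRadius) := by
    rw [measureReal_def, h1, ENNReal.toReal_mul, ENNReal.toReal_ofReal hl0.le, measureReal_def]
  have h3 := le_volume_real_quarterDisk le_rfl le_rfl
  have h4 : scaleIm l '' quarterDisk hexRadius hexRadius ⊆ quarterDisk a b := by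
    rintro _ ⟨z, ⟨z1, z2, z3, z4, z5⟩, rfl⟩
    refine ⟨z1, z2.trans ha, mul_pos hl0 z3, ?_, ?_⟩
    · change l * z.im ≤ b
      calc l * z.im ≤ l * hexRadius := by gcongr
        _ = b := by rw [hl]; field_simp
    · refine lt_of_le_of_lt ?_ z5
      apply le_of_sq_le_sq _ (norm_nonneg _)
      rw [← Complex.normSq_eq_norm_sq, ← Complex.normSq_eq_norm_sq, Complex.normSq_apply,
        Complex.normSq_apply]
      change z.re * z.re + (l * z.im) * (l * z.im) ≤ _
      have : l * z.im ≤ z.im := by nlinarith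
      have : 0 ≤ l * z.im := by positivity
      nlinarith
  calc l * (Real.pi / 12) ≤ l * volume.real (quarterDisk hexRadius hexRadius) := by gcongr
    _ = _ := h2.symm
    _ ≤ _ := measureReal_mono h4 (volume_quarterDisk_ne_top a b)

theorem volume_real_quarterDisk_comm (a b : ℝ) :
    volume.real (quarterDisk a b) = volume.real (quarterDisk b a) := by
  have hI : ‖(Complex.I : ℂ)‖ = 1 := Complex.norm_I
  let e : ℂ ≃ₗᵢ[ℝ] ℂ := Complex.conjLIE.trans
    (rotation ⟨Complex.I, mem_sphere_zero_iff_norm.2 hI⟩)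
  have he : ∀ z, e z = ⟨z.im, z.re⟩ := by
    intro z
    change Complex.I * (starRingEnd ℂ) z = _
    apply Complex.ext <;> simp
  rw [← e.measurePreserving.measureReal_preimage
    (measurableSet_quarterDisk b a).nullMeasurableSet]
  congr 1
  ext z
  have hn : ‖(⟨z.im, z.re⟩ : ℂ)‖ = ‖z‖ := by rw [← he, LinearIsometryEquiv.norm_map]
  simp only [quarterDisk, Set.mem_preimage, he, Set.mem_ofPred_eq, hn]
  tauto

/-- The reflections of the plane in the coordinate axes and the point reflection. -/
noncomputable def quadrantMap : Fin 4 → (ℂ ≃ₗᵢ[ℝ] ℂ) :=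
  ![LinearIsometryEquiv.refl ℝ ℂ, Complex.conjLIE, LinearIsometryEquiv.neg ℝ,
    Complex.conjLIE.trans (LinearIsometryEquiv.neg ℝ)]

/-- The quadrants at `p` are disjoint, each is limited by the two walls it faces, and `quadrantMap`
carries each to the first quadrant. -/
theorem sum_quarterDisk_le_volume_real_ball_inter {t : ℝ} {p : ℂ} (hp : p ∈ complexSquare t) :
    volume.real (quarterDisk (wall t 1 p) (wall t 3 p)) +
      volume.real (quarterDisk (wall t 1 p) (wall t 2 p)) +
      volume.real (quarterDisk (wall t 0 p) (wall t 2 p)) +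
      volume.real (quarterDisk (wall t 0 p) (wall t 3 p)) ≤
    volume.real (Metric.ball p hexRadius ∩ complexSquare t) := by
  set S : Fin 4 → Set ℂ := ![quarterDisk (wall t 1 p) (wall t 3 p),
    quarterDisk (wall t 1 p) (wall t 2 p), quarterDisk (wall t 0 p) (wall t 2 p),
    quarterDisk (wall t 0 p) (wall t 3 p)] with hS
  have hSm : ∀ s, MeasurableSet (S s) := by
    intro s; fin_cases s <;> exact measurableSet_quarterDisk _ _
  set A : Fin 4 → Set ℂ := fun s => (fun x => quadrantMap s (x - p)) ⁻¹' S s with hA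
  have hmp : ∀ s, MeasurePreserving (fun x => quadrantMap s (x - p)) volume volume := fun s =>
    (quadrantMap s).measurePreserving.comp (measurePreserving_sub_right volume p)
  have hAm : ∀ s, MeasurableSet (A s) := fun s => (hmp s).measurable (hSm s)
  have hfin : volume (Metric.ball p hexRadius ∩ complexSquare t) ≠ ⊤ :=
    measure_ne_top_of_subset Set.inter_subset_left measure_ball_lt_top.ne
  have hball : ∀ s x, ‖quadrantMap s (x - p)‖ < hexRadius → x ∈ Metric.ball p hexRadius := by
    intro s x h
    rwa [LinearIsometryEquiv.norm_map, ← dist_eq_norm] at h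
  have hp' := mem_complexSquare_iff.1 hp
  simp [Fin.forall_fin_succ, wall] at hp'
  have hsub : ∀ s, A s ⊆ Metric.ball p hexRadius ∩ complexSquare t := by
    intro s x hx
    fin_cases s
    all_goals
      refine ⟨hball _ x hx.2.2.2.2, ?_⟩
      obtain ⟨h1, h2, h3, h4, -⟩ := hx
      simp [quadrantMap, wall] at h1 h2 h3 h4
      rw [mem_complexSquare_iff]
      simp [Fin.forall_fin_succ, wall]
      refine ⟨?_, ?_, ?_, ?_⟩ <;> linarith
  have hdisj : Set.PairwiseDisjoint (↑(Finset.univ : Finset (Fin 4))) A := by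
    intro s _ s' _ hne
    rw [Function.onFun, Set.disjoint_left]
    intro x hx hx'
    obtain ⟨h1, -, h3, -⟩ : 0 < (quadrantMap s (x - p)).re ∧ True ∧
        0 < (quadrantMap s (x - p)).im ∧ True := by
      fin_cases s <;> exact ⟨hx.1, trivial, hx.2.2.1, trivial⟩
    obtain ⟨h1', -, h3', -⟩ : 0 < (quadrantMap s' (x - p)).re ∧ True ∧
        0 < (quadrantMap s' (x - p)).im ∧ True := by
      fin_cases s' <;> exact ⟨hx'.1, trivial, hx'.2.2.1, trivial⟩
    fin_cases s <;> fin_cases s' <;> simp [quadrantMap] at hne h1 h3 h1' h3' <;> linarith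
  have hsum : volume.real (⋃ s ∈ (Finset.univ : Finset (Fin 4)), A s) = ∑ s, volume.real (A s) :=
    measureReal_biUnion_finset (h := fun s _ => measure_ne_top_of_subset (hsub s) hfin)
      hdisj (fun s _ => hAm s)
  have hval : ∀ s, volume.real (A s) = volume.real (S s) :=
    fun s => (hmp s).measureReal_preimage (hSm s).nullMeasurableSet
  have hle := measureReal_mono (μ := volume)
    (Set.iUnion₂_subset fun s (_ : s ∈ (Finset.univ : Finset (Fin 4))) => hsub s) hfin
  rw [hsum, Fin.sum_univ_four, hval, hval, hval, hval] at hle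
  exact hle

/-! ### Boundary credits and Groemer's inequality -/

/-- The length of the interval on a side of the square that is assigned to a point at distance
`h` from that side. -/
noncomputable def shadow (h : ℝ) : ℝ := if h < hexRadius then 1 - h else 0

theorem shadow_nonneg (h : ℝ) : 0 ≤ shadow h := by
  unfold shadow; split_ifs with hh
  · linarith [hexRadius_lt]
  · exact le_rfl

/-- This is the balance of one quadrant, facing walls at distances `a` and `b`. Each wall belongs to
two quadrants, so the charge `3/10` splits into `3/20 + 3/20`, and each half-interval, clipped at
the corner, is credited to the quadrant facing it. -/
theorem corner_inequality {a b : ℝ} (ha : 0 ≤ a) (hb : 0 ≤ b) :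
    √3 / 8 + 3 / 20 * (if a < hexRadius then a else 0) +
      3 / 20 * (if b < hexRadius then b else 0) ≤
    3 * √3 / (2 * Real.pi) * volume.real (quarterDisk a b) +
      √3 / 8 * (2 * min (shadow b / 2) a + 2 * min (shadow a / 2) b +
        if a < hexRadius ∧ b < hexRadius then 1 else 0) := by
  have hpi := Real.pi_pos
  have hR := hexRadius_lt
  have hR' := lt_hexRadius
  have h3 : (√3) ^ 2 = 3 := Real.sq_sqrt (by norm_num)
  have h30 : 1.732 < √3 := Real.lt_sqrt_of_sq_lt (by norm_num)
  have hG : 0 ≤ 3 * √3 / (2 * Real.pi) * volume.real (quarterDisk a b) :=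
    mul_nonneg (by positivity) measureReal_nonneg
  have hstrip : ∀ {a b : ℝ}, 0 ≤ b → hexRadius ≤ a → b < hexRadius →
      √3 / 8 + 3 / 20 * b ≤ 3 * √3 / (2 * Real.pi) * volume.real (quarterDisk a b) +
        √3 / 8 * (1 - b) := by
    intro a b hb ha hbR
    have h1 := le_volume_real_quarterDisk_strip ha hb hbR.le
    have h2 : 3 * √3 / (2 * Real.pi) * (√3 * b * (Real.pi / 12)) ≤
      3 * √3 / (2 * Real.pi) * volume.real (quarterDisk a b) := by gcongr
    have e : 3 * √3 / (2 * Real.pi) * (√3 * b * (Real.pi / 12)) = 3 / 8 * b := by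
      field_simp; rw [h3]; ring
    rw [e] at h2
    have : √3 ≤ 1.8 := by rw [Real.sqrt_le_left (by norm_num)]; norm_num
    -- What remains is `3/20 ≤ 3/8 - √3/8 ≈ 0.158`, which leaves little room in the constant `3/40`
    -- of the error bound.
    nlinarith
  unfold shadow
  by_cases h1 : a < hexRadius <;> by_cases h2 : b < hexRadius
  -- Close to both walls the disk area is not needed: the corner credit pays `√3/8` and the clipped
  -- intervals pay the two charges.
  · rw [if_pos h1, if_pos h2, if_pos h1, if_pos h2, if_pos ⟨h1, h2⟩]
    rcases le_total ((1 - b) / 2) a with h4 | h4 <;>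
      rcases le_total ((1 - a) / 2) b with h5 | h5
    · rw [min_eq_left h4, min_eq_left h5]; nlinarith
    · rw [min_eq_left h4, min_eq_right h5]; nlinarith
    · rw [min_eq_right h4, min_eq_left h5]; nlinarith
    · rw [min_eq_right h4, min_eq_right h5]; nlinarith
  · have h5 := hstrip ha (not_lt.1 h2) h1
    rw [volume_real_quarterDisk_comm] at h5
    rw [if_pos h1, if_neg h2, if_pos h1, if_neg h2, if_neg (fun h => h2 h.2)]
    rw [zero_div, min_eq_left ha, min_eq_left (by linarith)]
    linarith
  · have h5 := hstrip hb (not_lt.1 h1) h2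
    rw [if_pos h2, if_neg h1, if_pos h2, if_neg h1, if_neg (fun h => h1 h.1)]
    rw [zero_div, min_eq_left hb, min_eq_left (by linarith)]
    linarith
  · have h5 := le_volume_real_quarterDisk (not_lt.1 h1) (not_lt.1 h2)
    have h6 : 3 * √3 / (2 * Real.pi) * (Real.pi / 12) ≤
      3 * √3 / (2 * Real.pi) * volume.real (quarterDisk a b) := by gcongr
    have e : 3 * √3 / (2 * Real.pi) * (Real.pi / 12) = √3 / 8 := by field_simp; norm_num
    rw [if_neg h1, if_neg h2, if_neg h1, if_neg h2, if_neg (fun h => h1 h.1), zero_div,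
      min_eq_left ha, min_eq_left hb]
    linarith

theorem sum_interval_le {ι : Type*} (s : Finset ι) {τ w : ι → ℝ} {t : ℝ} (ht : 0 ≤ t)
    (h0 : ∀ i, 0 ≤ τ i) (h1 : ∀ i, τ i ≤ t) (hw : ∀ i, 0 ≤ w i)
    (hsep : ∀ i ∈ s, ∀ j ∈ s, i ≠ j → w i / 2 + w j / 2 ≤ |τ i - τ j|) :
    ∑ i ∈ s, (min (w i / 2) (τ i) + min (w i / 2) (t - τ i)) ≤ t := by
  set I : ι → Set ℝ := fun i => Set.Ioo (τ i - min (w i / 2) (τ i))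
    (τ i + min (w i / 2) (t - τ i)) with hI
  have hm1 : ∀ i, 0 ≤ min (w i / 2) (τ i) := fun i => le_min (by linarith [hw i]) (h0 i)
  have hm2 : ∀ i, 0 ≤ min (w i / 2) (t - τ i) :=
    fun i => le_min (by linarith [hw i]) (by linarith [h1 i])
  have hlen : ∀ i, volume.real (I i) = min (w i / 2) (τ i) + min (w i / 2) (t - τ i) := by
    intro i
    rw [Real.volume_real_Ioo_of_le (by linarith [hm1 i, hm2 i])]
    ring
  have hsub : ∀ i, I i ⊆ Set.Icc 0 t := by
    rintro i x ⟨hx1, hx2⟩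
    have := min_le_right (w i / 2) (τ i)
    have := min_le_right (w i / 2) (t - τ i)
    exact ⟨by linarith, by linarith⟩
  have hfin : volume (Set.Icc (0 : ℝ) t) ≠ ⊤ := by simp
  have hdisj : Set.PairwiseDisjoint (↑s) I := by
    intro i hi j hj hne
    rw [Function.onFun, Set.disjoint_left]
    rintro x ⟨hx1, hx2⟩ ⟨hx3, hx4⟩
    have a1 := min_le_left (w i / 2) (τ i)
    have a2 := min_le_left (w i / 2) (t - τ i)
    have a3 := min_le_left (w j / 2) (τ j)
    have a4 := min_le_left (w j / 2) (t - τ j)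
    rcases le_abs.1 (hsep i hi j hj hne) with h | h <;> linarith
  have hsum := measureReal_biUnion_finset (μ := volume) hdisj (fun i _ => measurableSet_Ioo)
    (h := fun i _ => measure_ne_top_of_subset (hsub i) hfin)
  have hle := measureReal_mono (μ := volume) (Set.iUnion₂_subset fun i (_ : i ∈ s) => hsub i) hfin
  rw [hsum, Real.volume_real_Icc_of_le ht, sub_zero] at hle
  simpa only [hlen] using hle

theorem sum_shadow_le {ι : Type*} [Fintype ι] {τ h : ι → ℝ} {t : ℝ} (ht : 0 ≤ t)
    (h0 : ∀ i, 0 ≤ τ i) (h1 : ∀ i, τ i ≤ t) (hh : ∀ i, 0 ≤ h i)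
    (hsep : ∀ i j, i ≠ j → 1 ≤ (τ i - τ j) ^ 2 + (h i - h j) ^ 2) :
    ∑ i, (min (shadow (h i) / 2) (τ i) + min (shadow (h i) / 2) (t - τ i)) ≤ t := by
  classical
  have hR := hexRadius_lt
  rw [← Finset.sum_subset (Finset.subset_univ (Finset.univ.filter fun i => h i < hexRadius))]
  · refine sum_interval_le _ ht h0 h1 (fun i => shadow_nonneg _) ?_
    intro i hi j hj hne
    have hi' := (Finset.mem_filter.1 hi).2
    have hj' := (Finset.mem_filter.1 hj).2
    simp only [shadow, if_pos hi', if_pos hj']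
    apply le_of_sq_le_sq _ (abs_nonneg _)
    rw [sq_abs]
    have h2 := hsep i j hne
    have h3 := hh i
    have h4 := hh j
    -- With `Δ = |h i - h j| < hexRadius < 4/5` one has `(1 - (h i + h j)/2)² ≤ (1 - Δ/2)² ≤ 1 -
    -- Δ²`.
    rcases le_total (h i) (h j) with h5 | h5 <;> nlinarith
  · intro i _ hi
    have hi' : ¬ h i < hexRadius := fun h' => hi (by simp [h'])
    rw [shadow, if_neg hi', zero_div, min_eq_left (h0 i),
      min_eq_left (by linarith [h1 i]), add_zero]

theorem sum_corner_le_one {ι : Type*} [Fintype ι] {a b : ι → ℝ} (ha : ∀ i, 0 ≤ a i)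
    (hb : ∀ i, 0 ≤ b i) (hsep : ∀ i j, i ≠ j → 1 ≤ (a i - a j) ^ 2 + (b i - b j) ^ 2) :
    ∑ i, (if a i < hexRadius ∧ b i < hexRadius then (1 : ℝ) else 0) ≤ 1 := by
  classical
  rw [← Finset.sum_filter, Finset.sum_const, nsmul_eq_mul, mul_one]
  have : (Finset.univ.filter fun i => a i < hexRadius ∧ b i < hexRadius).card ≤ 1 := by
    refine Finset.card_le_one.2 fun i hi j hj => ?_
    by_contra hne
    obtain ⟨-, i1, i2⟩ := Finset.mem_filter.1 hi
    obtain ⟨-, j1, j2⟩ := Finset.mem_filter.1 hj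
    have h1 := hsep i j hne
    have h2 : (a i - a j) ^ 2 ≤ hexRadius ^ 2 :=
      sq_le_sq' (by linarith [ha i]) (by linarith [ha j])
    have h3 : (b i - b j) ^ 2 ≤ hexRadius ^ 2 :=
      sq_le_sq' (by linarith [hb i]) (by linarith [hb j])
    rw [hexRadius_sq] at h2 h3
    linarith
  exact_mod_cast this

/-- **Groemer's inequality** for a square: the number of points of `[0, t] × [0, t]` at mutual
distance at least `1` is at most `2 / √3 * t ^ 2 + 2 * t + 1`. -/
theorem card_le_of_one_le_dist {ι : Type*} [Fintype ι] {c : ι → ℂ} {t : ℝ} (ht : 0 ≤ t)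
    (hc : ∀ i j, i ≠ j → 1 ≤ ‖c j - c i‖) (hQ : ∀ i, c i ∈ complexSquare t) :
    √3 / 2 * Fintype.card ι ≤ t ^ 2 + √3 * t + √3 / 2 := by
  classical
  have hnn : ∀ k i, 0 ≤ wall t k (c i) := fun k i => mem_complexSquare_iff.1 (hQ i) k
  have hsep : ∀ k i j, i ≠ j → 1 ≤ (wallCoord k (c i) - wallCoord k (c j)) ^ 2 +
      (wall t k (c i) - wall t k (c j)) ^ 2 := by
    intro k i j hij
    rw [← norm_sub_sq_eq_wall]
    have := hc i j hij
    nlinarith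
  have hvol := sum_volume_ball_inter_square_le ht hc hQ
  have htips := sum_outside_tips_le hc hQ
  have w01 : ∀ x, wall t 1 x = t - wall t 0 x := fun x => rfl
  have w23 : ∀ x, wall t 3 x = t - wall t 2 x := fun x => rfl
  have c0 : ∀ x, wallCoord 0 x = wall t 2 x := fun x => rfl
  have c1 : ∀ x, wallCoord 1 x = wall t 2 x := fun x => rfl
  have c2 : ∀ x, wallCoord 2 x = wall t 0 x := fun x => rfl
  have c3 : ∀ x, wallCoord 3 x = wall t 0 x := fun x => rfl
  have hle0 : ∀ i, wall t 0 (c i) ≤ t := fun i => by linarith [w01 (c i), hnn 1 i]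
  have hle2 : ∀ i, wall t 2 (c i) ≤ t := fun i => by linarith [w23 (c i), hnn 3 i]
  have s0 := sum_shadow_le ht (hnn 2) hle2 (hnn 0) (fun i j h => by
    rw [← c0, ← c0]; exact hsep 0 i j h)
  have s1 := sum_shadow_le ht (hnn 2) hle2 (hnn 1) (fun i j h => by
    rw [← c1, ← c1]; exact hsep 1 i j h)
  have s2 := sum_shadow_le ht (hnn 0) hle0 (hnn 2) (fun i j h => by
    rw [← c2, ← c2]; exact hsep 2 i j h)
  have s3 := sum_shadow_le ht (hnn 0) hle0 (hnn 3) (fun i j h => by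
    rw [← c3, ← c3]; exact hsep 3 i j h)
  have hbox : ∀ k l, (∀ i j, (wall t k (c i) - wall t k (c j)) ^ 2 +
      (wall t l (c i) - wall t l (c j)) ^ 2 = ‖c j - c i‖ ^ 2) →
      ∑ i, (if wall t k (c i) < hexRadius ∧ wall t l (c i) < hexRadius then (1 : ℝ) else 0)
        ≤ 1 := by
    intro k l hkl
    refine sum_corner_le_one (hnn k) (hnn l) fun i j hij => ?_
    rw [hkl]
    have := hc i j hij
    nlinarith
  have b02 := hbox 0 2 (fun i j => by rw [norm_sub_sq_eq_wall t 2, c2, c2])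
  have b12 := hbox 1 2 (fun i j => by
    rw [norm_sub_sq_eq_wall t 2, c2, c2, w01, w01]; ring)
  have b03 := hbox 0 3 (fun i j => by rw [norm_sub_sq_eq_wall t 3, c3, c3])
  have b13 := hbox 1 3 (fun i j => by
    rw [norm_sub_sq_eq_wall t 3, c3, c3, w01, w01]; ring)
  -- The sum of `corner_inequality` over the four quadrants at one point. Summed over all points,
  -- the charges cancel against `htips`.
  have hpt : ∀ i, √3 / 2 + 3 / 10 * ∑ k, (if wall t k (c i) < hexRadius then
        wall t k (c i) else 0) ≤
      3 * √3 / (2 * Real.pi) * volume.real (Metric.ball (c i) hexRadius ∩ complexSquare t) +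
      √3 / 8 * (
        2 * (min (shadow (wall t 0 (c i)) / 2) (wall t 2 (c i)) +
          min (shadow (wall t 0 (c i)) / 2) (t - wall t 2 (c i))) +
        2 * (min (shadow (wall t 1 (c i)) / 2) (wall t 2 (c i)) +
          min (shadow (wall t 1 (c i)) / 2) (t - wall t 2 (c i))) +
        2 * (min (shadow (wall t 2 (c i)) / 2) (wall t 0 (c i)) +
          min (shadow (wall t 2 (c i)) / 2) (t - wall t 0 (c i))) +
        2 * (min (shadow (wall t 3 (c i)) / 2) (wall t 0 (c i)) +
          min (shadow (wall t 3 (c i)) / 2) (t - wall t 0 (c i))) +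
        (if wall t 0 (c i) < hexRadius ∧ wall t 2 (c i) < hexRadius then 1 else 0) +
        (if wall t 1 (c i) < hexRadius ∧ wall t 2 (c i) < hexRadius then 1 else 0) +
        (if wall t 0 (c i) < hexRadius ∧ wall t 3 (c i) < hexRadius then 1 else 0) +
        (if wall t 1 (c i) < hexRadius ∧ wall t 3 (c i) < hexRadius then 1 else 0)) := by
    intro i
    have k02 := corner_inequality (hnn 0 i) (hnn 2 i)
    have k12 := corner_inequality (hnn 1 i) (hnn 2 i)
    have k03 := corner_inequality (hnn 0 i) (hnn 3 i)
    have k13 := corner_inequality (hnn 1 i) (hnn 3 i)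
    have hb := mul_le_mul_of_nonneg_left (sum_quarterDisk_le_volume_real_ball_inter (hQ i))
      (show 0 ≤ 3 * √3 / (2 * Real.pi) by positivity)
    rw [Fin.sum_univ_four, ← w01, ← w23]
    linarith
  have hsum := Finset.sum_le_sum (s := Finset.univ) fun i _ => hpt i
  simp only [Finset.sum_add_distrib, ← Finset.mul_sum] at hsum s0 s1 s2 s3
  rw [Finset.sum_comm] at hsum
  simp only [Finset.sum_const, Finset.card_univ, nsmul_eq_mul] at hsum
  have h3 : 0 < √3 := by positivity
  nlinarith

/-! ### From disk packings to separated points -/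

theorem volume_real_axisSquare {s : ℝ} (hs : 0 ≤ s) : volume.real (axisSquare s) = s ^ 2 := by
  have h1 : axisSquare s = @WithLp.ofLp 2 (Fin 2 → ℝ) ⁻¹' Set.Icc (fun _ => 0) (fun _ => s) := by
    ext x
    simp only [axisSquare, Set.mem_ofPred_eq, Set.mem_preimage, Set.mem_Icc, Pi.le_def]
    exact forall_and
  rw [h1, (PiLp.volume_preserving_ofLp (Fin 2)).measureReal_preimage
    measurableSet_Icc.nullMeasurableSet, measureReal_def, Real.volume_Icc_pi_toReal
    (fun _ => hs)]
  simp

theorem volume_real_isometryEquiv_image (φ : Plane ≃ᵢ Plane) (S : Set Plane)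
    (hS : MeasurableSet S) : volume.real (φ '' S) = volume.real S := by
  have hφ : MeasurePreserving φ.symm volume volume := by
    have h1 : ⇑φ.symm = fun x => φ.symm.toRealAffineIsometryEquiv.linearIsometryEquiv x +
        φ.symm 0 := by
      funext x
      have := φ.symm.toRealAffineIsometryEquiv.map_vadd 0 x
      simpa using this
    rw [h1]
    exact (measurePreserving_add_right volume _).comp
      (φ.symm.toRealAffineIsometryEquiv.linearIsometryEquiv.measurePreserving)
  rw [← hφ.measureReal_preimage hS.nullMeasurableSet]
  congr 1
  ext x
  constructor
  · rintro ⟨y, hy, rfl⟩; simpa using hy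
  · exact fun hx => ⟨φ.symm x, hx, by simp⟩

theorem measurableSet_axisSquare (s : ℝ) : MeasurableSet (axisSquare s) := by
  have h1 : axisSquare s = @WithLp.ofLp 2 (Fin 2 → ℝ) ⁻¹' Set.Icc (fun _ => 0) (fun _ => s) := by
    ext x
    simp only [axisSquare, Set.mem_ofPred_eq, Set.mem_preimage, Set.mem_Icc, Pi.le_def]
    exact forall_and
  rw [h1]
  exact (PiLp.volume_preserving_ofLp (Fin 2)).measurable measurableSet_Icc

theorem coord_mem_of_closedBall_subset_axisSquare {s r : ℝ} (hr : 0 < r) {x : Plane}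
    (h : Metric.closedBall x r ⊆ axisSquare s) (k : Fin 2) : r ≤ x k ∧ x k ≤ s - r := by
  have h1 : x + EuclideanSpace.single k r ∈ axisSquare s := h (by
    simp [abs_of_pos hr])
  have h2 : x - EuclideanSpace.single k r ∈ axisSquare s := h (by
    simp [abs_of_pos hr])
  have h3 := (h1 k).2
  have h4 := (h2 k).1
  simp at h3 h4
  exact ⟨h4, by linarith⟩

/-- The density of a disk packing in a square together with Groemer's bound, expressed through
the ratio `u` of the side of the square and the diameter of the disks. -/
theorem exists_density_eq {N : ℕ} (hN : 1 ≤ N) {Q : Set Plane} {r : ℝ} {c : Fin N → Plane}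
    (hQ : IsPlaneSquare Q) (hP : IsDiskPacking Q r c) :
    ∃ u : ℝ, 1 ≤ u ∧ packingDensity Q r c = N * Real.pi / (4 * u ^ 2) ∧
      √3 / 2 * N ≤ (u - 1) ^ 2 + √3 * (u - 1) + √3 / 2 := by
  obtain ⟨s, hs, φ, rfl⟩ := hQ
  obtain ⟨hr, hsub, hdisj⟩ := hP
  set c' : Fin N → Plane := fun i => φ.symm (c i) with hc'
  have hcoord : ∀ i k, r ≤ c' i k ∧ c' i k ≤ s - r := by
    intro i
    apply coord_mem_of_closedBall_subset_axisSquare hr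
    intro x hx
    have h1 : φ x ∈ Metric.closedBall (c i) r := by
      rw [Metric.mem_closedBall] at hx ⊢
      rwa [← φ.apply_symm_apply (c i), φ.isometry.dist_eq]
    obtain ⟨y, hy, hyx⟩ := hsub i h1
    rwa [φ.injective hyx] at hy
  have hdist : ∀ i j, i ≠ j → 2 * r ≤ dist (c' i) (c' j) := by
    intro i j hij
    have := (disjoint_ball_ball_iff hr hr).1 (hdisj i j hij)
    rw [hc', φ.symm.isometry.dist_eq]
    linarith
  have hsr : 2 * r ≤ s := by
    have := hcoord ⟨0, hN⟩ 0
    linarith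
  set u := s / (2 * r) with hu
  have hu1 : 1 ≤ u := by rw [hu, one_le_div (by positivity)]; exact hsr
  refine ⟨u, hu1, ?_, ?_⟩
  · unfold packingDensity
    rw [volume_real_isometryEquiv_image φ _ (measurableSet_axisSquare s),
      volume_real_axisSquare hs.le]
    have : ∀ i, volume.real (Metric.closedBall (c i) r) = r ^ 2 * Real.pi := by
      intro i
      rw [measureReal_def, EuclideanSpace.volume_closedBall_fin_two, ENNReal.toReal_mul,
        ENNReal.toReal_pow, ENNReal.toReal_ofReal hr.le,
        ENNReal.toReal_ofReal Real.pi_pos.le]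
    simp only [this, Finset.sum_const, Finset.card_univ, Fintype.card_fin, nsmul_eq_mul]
    rw [hu]
    field_simp
    norm_num
  -- The centers keep distance `r` from the sides, hence fill a square of side `s - 2r`, which is `u
  -- - 1` in units of the diameter.
  · have h1 := card_le_of_one_le_dist (t := u - 1)
      (c := fun i => (⟨(c' i 0 - r) / (2 * r), (c' i 1 - r) / (2 * r)⟩ : ℂ))
      (by linarith) ?_ ?_
    · simpa using h1
    · intro i j hij
      have h2 := pow_le_pow_left₀ (by positivity) (hdist i j hij) 2
      rw [EuclideanSpace.dist_eq, Real.sq_sqrt (by positivity), Fin.sum_univ_two, Real.dist_eq,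
        Real.dist_eq, sq_abs, sq_abs] at h2
      rw [← one_le_sq_iff₀ (norm_nonneg _), ← Complex.normSq_eq_norm_sq, Complex.normSq_apply]
      simp only [Complex.sub_re, Complex.sub_im]
      have e : ((c' j 0 - r) / (2 * r) - (c' i 0 - r) / (2 * r)) *
          ((c' j 0 - r) / (2 * r) - (c' i 0 - r) / (2 * r)) +
          ((c' j 1 - r) / (2 * r) - (c' i 1 - r) / (2 * r)) *
          ((c' j 1 - r) / (2 * r) - (c' i 1 - r) / (2 * r)) =
          ((c' i 0 - c' j 0) ^ 2 + (c' i 1 - c' j 1) ^ 2) / (2 * r) ^ 2 := by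
        field_simp; ring
      rw [e, one_le_div (by positivity)]
      exact h2
    · intro i
      have e : ∀ k, 0 ≤ (c' i k - r) / (2 * r) ∧ (c' i k - r) / (2 * r) ≤ u - 1 := by
        intro k
        obtain ⟨h2, h3⟩ := hcoord i k
        refine ⟨div_nonneg (by linarith) (by positivity), ?_⟩
        rw [div_le_iff₀ (by positivity), hu, sub_mul, div_mul_cancel₀ _ (by positivity)]
        linarith
      exact ⟨e 0, e 1⟩

/-! ### From Groemer's inequality to the density bounds -/

theorem pi_div_sqrt_twelve : Real.pi / √12 = Real.pi / 4 * (2 / √3) := by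
  have : √12 = 2 * √3 := by
    rw [show (12 : ℝ) = 2 ^ 2 * 3 by norm_num, Real.sqrt_mul (by norm_num),
      Real.sqrt_sq (by norm_num)]
  rw [this]
  field_simp
  norm_num

theorem groemer_bound {n u : ℝ} (h : √3 / 2 * n ^ 2 ≤ (u - 1) ^ 2 + √3 * (u - 1) + √3 / 2) :
    n ^ 2 ≤ u ^ 2 + (2 / √3 - 1) * (u - 1) ^ 2 := by
  have h3 : 0 < √3 := by positivity
  have e : n ^ 2 = 2 / √3 * (√3 / 2 * n ^ 2) := by field_simp
  have e2 : 2 / √3 * ((u - 1) ^ 2 + √3 * (u - 1) + √3 / 2) =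
      u ^ 2 + (2 / √3 - 1) * (u - 1) ^ 2 := by field_simp; ring
  rw [e, ← e2]
  gcongr

theorem two_div_sqrt_three_bounds : 1.1547 < 2 / √3 ∧ 2 / √3 < 1.154701 := by
  have h3 : 0 < √3 := by positivity
  have h1 : √3 < 1.7320509 := by rw [Real.sqrt_lt' (by norm_num)]; norm_num
  have h2 : 1.7320508 < √3 := Real.lt_sqrt_of_sq_lt (by norm_num)
  constructor
  · rw [lt_div_iff₀ h3]; linarith
  · rw [div_lt_iff₀ h3]; linarith

theorem deficiency_ge {n u : ℝ} (hn : 1 ≤ n) (hu : 1 ≤ u)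
    (h : √3 / 2 * n ^ 2 ≤ (u - 1) ^ 2 + √3 * (u - 1) + √3 / 2) :
    (Real.pi / √12 - Real.pi / 4) / n ≤ Real.pi / √12 - n ^ 2 * Real.pi / (4 * u ^ 2) := by
  have hG := groemer_bound h
  obtain ⟨hq, -⟩ := two_div_sqrt_three_bounds
  rw [pi_div_sqrt_twelve]
  set q := 2 / √3
  have hpi := Real.pi_pos
  have key : (q - 1) * u ^ 2 ≤ n * (q * u ^ 2 - n ^ 2) := by
    -- For `n ≤ u` the density is at most `π/4` and `n ≥ 1` suffices. For `n ≥ u` Groemer's bound is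
    -- needed, with `(u - 1)² = u² - (2u - 1)` and `u² ≤ u (2u - 1) ≤ n (2u - 1)`.
    rcases le_total n u with hnu | hnu
    · have h1 : 0 ≤ (q - 1) * u ^ 2 * (n - 1) :=
        mul_nonneg (mul_nonneg (by linarith) (sq_nonneg _)) (by linarith)
      have h2 : 0 ≤ n * (u ^ 2 - n ^ 2) := mul_nonneg (by linarith) (by nlinarith)
      linarith
    · have h1 : (q - 1) * (2 * u - 1) ≤ q * u ^ 2 - n ^ 2 := by linarith
      have h2 : u ^ 2 ≤ n * (2 * u - 1) := by nlinarith
      calc (q - 1) * u ^ 2 ≤ (q - 1) * (n * (2 * u - 1)) :=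
            mul_le_mul_of_nonneg_left h2 (by linarith)
        _ = n * ((q - 1) * (2 * u - 1)) := by ring
        _ ≤ _ := mul_le_mul_of_nonneg_left h1 (by linarith)
  have e : Real.pi / 4 * q - n ^ 2 * Real.pi / (4 * u ^ 2) =
      Real.pi / 4 * (n * (q * u ^ 2 - n ^ 2)) / u ^ 2 / n := by field_simp
  have e2 : (Real.pi / 4 * q - Real.pi / 4) / n =
      Real.pi / 4 * ((q - 1) * u ^ 2) / u ^ 2 / n := by field_simp
  rw [e, e2]
  gcongr

theorem lt_deficiency {n u : ℝ} (hn : 35 ≤ n ^ 2) (hn0 : 0 < n) (hu : 1 ≤ u)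
    (h : √3 / 2 * n ^ 2 ≤ (u - 1) ^ 2 + √3 * (u - 1) + √3 / 2) :
    (Real.pi / 2 * (2 / √3 - 1) * (3 / 2) * √(Real.pi / √12 - 1 / 2)) / n <
      Real.pi / √12 - n ^ 2 * Real.pi / (4 * u ^ 2) := by
  have hG := groemer_bound h
  obtain ⟨hq, hq'⟩ := two_div_sqrt_three_bounds
  have hpi := Real.pi_pos
  have hκ : √(Real.pi / √12 - 1 / 2) < 0.63789 := by
    rw [Real.sqrt_lt' (by norm_num), pi_div_sqrt_twelve]
    have := Real.pi_lt_d6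
    nlinarith
  have hκ0 : 0 ≤ √(Real.pi / √12 - 1 / 2) := Real.sqrt_nonneg _
  generalize √(Real.pi / √12 - 1 / 2) = κ at hκ hκ0 ⊢
  rw [pi_div_sqrt_twelve]
  set q := 2 / √3
  have hu0 : 0 < u := by linarith
  have key : n ^ 2 / u ^ 2 < q - 3 * (q - 1) * κ / n := by
    by_contra! hcon
    set v := u / n with hv
    set ε := 1 / n with hε
    have hv0 : 0 < v := by positivity
    have hε0 : 0 < ε := by positivity
    have hεv : ε ≤ v := by rw [hε, hv]; gcongr
    -- This is where `N ≥ 35` enters: `1/√35 ≈ 0.16903`.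
    have hε1 : ε < 0.169031 := by
      rw [hε, div_lt_iff₀ hn0]
      have : 5.916075 < n := by nlinarith
      linarith
    have a1 : v ^ 2 * (q - 3 * (q - 1) * κ * ε) ≤ 1 := by
      have : v ^ 2 * (q - 3 * (q - 1) * κ * ε) ≤ v ^ 2 * (n ^ 2 / u ^ 2) := by
        gcongr
        rw [hε]; convert hcon using 2; ring
      refine this.trans_eq ?_
      rw [hv]; field_simp
    have a2 : 1 ≤ v ^ 2 + (q - 1) * (v - ε) ^ 2 := by
      have e : v ^ 2 + (q - 1) * (v - ε) ^ 2 = (u ^ 2 + (q - 1) * (u - 1) ^ 2) / n ^ 2 := by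
        rw [hv, hε]; field_simp
      rw [e, one_le_div (by positivity)]
      exact hG
    -- Eliminating `1` between `a1` and `a2` leaves this quadratic times `(q - 1) ε`. It is refuted
    -- by confining `v` to `[0.93, 0.9515]`: the lower end comes from `a2`, which gives `q v² ≥ 1`,
    -- the upper end from `a1`.
    have a3 : 0 ≤ 3 * κ * v ^ 2 - 2 * v + ε := by
      have : 0 ≤ (q - 1) * ε * (3 * κ * v ^ 2 - 2 * v + ε) := by linarith
      exact nonneg_of_mul_nonneg_right this (by nlinarith)
    have a4 : 0.93 ≤ v := by nlinarith
    have a5 : (q - 1) * κ * ε ≤ 0.154701 * 0.63789 * 0.169031 := by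
      gcongr; linarith
    have a6 : v ≤ 0.9515 := by
      by_contra! hc
      have : 0.9515 ^ 2 < v ^ 2 := by gcongr
      nlinarith
    -- The quadratic is convex in `v` and negative at both ends of the interval, at the upper end
    -- only by about `0.001`.
    nlinarith [mul_nonneg (sub_nonneg.2 a4) (sub_nonneg.2 a6)]
  have e : Real.pi / 4 * q - n ^ 2 * Real.pi / (4 * u ^ 2) =
      Real.pi / 4 * (q - n ^ 2 / u ^ 2) := by field_simp
  have e2 : Real.pi / 2 * (q - 1) * (3 / 2) * κ / n =
      Real.pi / 4 * (3 * (q - 1) * κ / n) := by ring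
  rw [e, e2]
  apply mul_lt_mul_of_pos_left _ (by positivity)
  linarith

theorem packing_deficiency_ge {N : ℕ} (hN : 1 ≤ N) {Q : Set Plane} {r : ℝ} {c : Fin N → Plane}
    (hQ : IsPlaneSquare Q) (hP : IsDiskPacking Q r c) :
    (Real.pi / √12 - Real.pi / 4) / √(N : ℝ) ≤ Real.pi / √12 - packingDensity Q r c := by
  obtain ⟨u, hu, hd, h⟩ := exists_density_eq hN hQ hP
  have hN' : (1 : ℝ) ≤ N := by exact_mod_cast hN
  have hs : √(N : ℝ) ^ 2 = N := Real.sq_sqrt (by linarith)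
  rw [hd]
  conv_rhs => rw [← hs]
  rw [← hs] at h
  exact deficiency_ge (Real.one_le_sqrt.2 hN') hu h

theorem pi_div_four_lt : 0 < Real.pi / √12 - Real.pi / 4 := by
  rw [pi_div_sqrt_twelve]
  have := two_div_sqrt_three_bounds.1
  nlinarith [Real.pi_pos]

theorem mainTheorem2 :
    (∃ k : ℝ, 0 < k ∧
      (∀ (N : ℕ), 1 ≤ N → ∀ (Q : Set Plane) (r : ℝ) (c : Fin N → Plane),
        IsPlaneSquare Q → IsDiskPacking Q r c →
          k / √(N : ℝ) < Real.pi / √12 - packingDensity Q r c) ∧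
      (∀ (N : ℕ), 1 ≤ N → k / √(N : ℝ) < Real.pi / √12 - maxSquareDensity N)) ∧
    (∀ (N : ℕ), 1 ≤ N → ∀ (Q : Set Plane) (r : ℝ) (c : Fin N → Plane),
      IsPlaneSquare Q → IsDiskPacking Q r c →
        (Real.pi / √12 - Real.pi / 4) / √(N : ℝ) ≤ Real.pi / √12 - packingDensity Q r c) ∧
    (∀ (N : ℕ), 35 ≤ N → ∀ (Q : Set Plane) (r : ℝ) (c : Fin N → Plane),
      IsPlaneSquare Q → IsDiskPacking Q r c →
        (Real.pi / 2 * (2 / √3 - 1) * (3 / 2) * √(Real.pi / √12 - 1 / 2)) / √(N : ℝ) <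
          Real.pi / √12 - packingDensity Q r c) := by
  have hpos := pi_div_four_lt
  -- Half of the constant of (b), so that the inequality becomes strict and remains so for the
  -- supremum.
  refine ⟨⟨(Real.pi / √12 - Real.pi / 4) / 2, by linarith, ?_, ?_⟩, ?_, ?_⟩
  · intro N hN Q r c hQ hP
    have hs : 0 < √(N : ℝ) := Real.sqrt_pos.2 (by exact_mod_cast hN)
    exact lt_of_lt_of_le (div_lt_div_of_pos_right (by linarith) hs)
      (packing_deficiency_ge hN hQ hP)
  · intro N hN
    have hs : 0 < √(N : ℝ) := Real.sqrt_pos.2 (by exact_mod_cast hN)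
    have hs1 : 1 ≤ √(N : ℝ) := Real.one_le_sqrt.2 (by exact_mod_cast hN)
    have h1 : maxSquareDensity N ≤
        Real.pi / √12 - (Real.pi / √12 - Real.pi / 4) / √(N : ℝ) := by
      refine Real.sSup_le ?_ ?_
      · rintro δ ⟨Q, r, c, hQ, hP, rfl⟩
        linarith [packing_deficiency_ge hN hQ hP]
      -- `Real.sSup_le` also asks that the bound be nonnegative, because the supremum of the empty
      -- set is `0` by convention.
      · have := div_le_self hpos.le hs1
        linarith [Real.pi_pos]
    have h2 : (Real.pi / √12 - Real.pi / 4) / 2 / √(N : ℝ) <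
        (Real.pi / √12 - Real.pi / 4) / √(N : ℝ) :=
      div_lt_div_of_pos_right (by linarith) hs
    linarith
  · exact fun N hN Q r c hQ hP => packing_deficiency_ge hN hQ hP
  · intro N hN Q r c hQ hP
    obtain ⟨u, hu, hd, h⟩ := exists_density_eq (by omega) hQ hP
    have hN' : (35 : ℝ) ≤ N := by exact_mod_cast hN
    have hs : √(N : ℝ) ^ 2 = N := Real.sq_sqrt (by linarith)
    rw [hd]
    conv_rhs => rw [← hs]
    rw [← hs] at h
    exact lt_deficiency (by rw [hs]; exact hN') (Real.sqrt_pos.2 (by linarith)) hu h
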